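/- For complex $q$ with $|q|<1$ put $(x;q)_n=\prod_{i=0}^{n-1}(1-xq^i)$ and $(x_1,\dots,x_r;q)_n=(x_1;q)_n\cdots(x_r;q)_n$, and let $$a(q)=\sum_{m,n=-\infty}^{\infty}q^{m^2+mn+n^2}$$ be the Borwein cubic theta series. Let $0<|q|<1$, and let $\rho_1,\rho_2$ be non-zero complex numbers such that no denominator below vanishes, i.e. $\rho_1\ne q^{3j+2}$, $\rho_2\neq q^{3j+2}$ and $\rho_1\rho_2q^{3j+1}\ne 1$ for all integers $j\ge 0$. Then the following series all converge absolutely, and $$\begin{aligned} a(q)&=1+6\sum_{n=1}^\infty\frac{(q;q^3)_n\,q^n}{(q^2;q^3)_n(1-q^{3n})}\\ &=1-6\sum_{n=1}^\infty\frac{(1-q^{6n-1})(1/q,1/q;q^3)_n(q^3;q^3)_{2n-1}\,q^{2n}}{(1-1/q)(q^3,q^3;q^3)_n(q;q^3)_{2n}}\\ &=1+6\sum_{n=1}^\infty\frac{(\rho_1q,\rho_2q,q^2/(\rho_1\rho_2);q^3)_n\,q^n}{(q^2/\rho_1,q^2/\rho_2,\rho_1\rho_2q;q^3)_n(1-q^{3n})}\\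 &\quad-6\sum_{n=1}^\infty\frac{(1-q^{6n-1})(1/q,\rho_1,\rho_2,q/(\rho_1\rho_2);q^3)_n(q^3;q^3)_{2n-1}\,q^{2n}}{(1-1/q)(q^2/\rho_1,q^2/\rho_2,\rho_1\rho_2q,q^3;q^3)_n(q;q^3)_{2n}}\\ &=1+6\sum_{n=1}^\infty\frac{(-1)^nq^{(3n^2+n)/2}}{1-q^{3n}}\\ &\quad-6\sum_{n=1}^\infty\frac{(1-q^{6n-1})(1/q;q^3)_n(q^3;q^3)_{2n-1}(-1)^nq^{(3n^2-n)/2}}{(1-1/q)(q^3;q^3)_n(q;q^3)_{2n}}. \end{aligned}$$ The conditions on $\rho_1,\rho_2$ concern only the third representation. -/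

import Mathlib

/-- The finite `q`-shifted factorial `(a; q)_n = (1 - a)(1 - a q) ⋯ (1 - a q ^ (n - 1))`. -/
def qPoch (a q : ℂ) (n : ℕ) : ℂ := ∏ i ∈ Finset.range n, (1 - a * q ^ i)

/-- The term `q ^ (m² + m n + n²)` of the cubic theta series; the integer exponent is
nonnegative. -/
noncomputable def cubicThetaTerm (q : ℂ) (p : ℤ × ℤ) : ℂ :=
  q ^ (p.1 ^ 2 + p.1 * p.2 + p.2 ^ 2)

/-- The Borwein cubic theta series `a(q) = ∑_{m, n ∈ ℤ} q ^ (m² + m n + n²)`. -/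
noncomputable def cubicTheta (q : ℂ) : ℂ := ∑' p : ℤ × ℤ, cubicThetaTerm q p

/-- `(q; q³)_n q^n / ((q²; q³)_n (1 - q^{3n}))`. -/
noncomputable def seriesOne (q : ℂ) (n : ℕ+) : ℂ :=
  qPoch q (q ^ 3) n * q ^ (n : ℕ) / (qPoch (q ^ 2) (q ^ 3) n * (1 - q ^ (3 * (n : ℕ))))

/-- `(1 - q^{6n-1}) (1/q, 1/q; q³)_n (q³; q³)_{2n-1} q^{2n}
  / ((1 - 1/q) (q³, q³; q³)_n (q; q³)_{2n})`. -/
noncomputable def seriesTwo (q : ℂ) (n : ℕ+) : ℂ :=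
  (1 - q ^ (6 * (n : ℕ) - 1)) * (qPoch (1 / q) (q ^ 3) n * qPoch (1 / q) (q ^ 3) n)
      * qPoch (q ^ 3) (q ^ 3) (2 * (n : ℕ) - 1) * q ^ (2 * (n : ℕ))
    / ((1 - 1 / q) * (qPoch (q ^ 3) (q ^ 3) n * qPoch (q ^ 3) (q ^ 3) n)
      * qPoch q (q ^ 3) (2 * (n : ℕ)))

/-- `(ρ₁ q, ρ₂ q, q²/(ρ₁ρ₂); q³)_n q^n / ((q²/ρ₁, q²/ρ₂, ρ₁ρ₂ q; q³)_n (1 - q^{3n}))`. -/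
noncomputable def seriesThreeFst (q ρ₁ ρ₂ : ℂ) (n : ℕ+) : ℂ :=
  qPoch (ρ₁ * q) (q ^ 3) n * qPoch (ρ₂ * q) (q ^ 3) n * qPoch (q ^ 2 / (ρ₁ * ρ₂)) (q ^ 3) n
      * q ^ (n : ℕ)
    / (qPoch (q ^ 2 / ρ₁) (q ^ 3) n * qPoch (q ^ 2 / ρ₂) (q ^ 3) n
      * qPoch (ρ₁ * ρ₂ * q) (q ^ 3) n * (1 - q ^ (3 * (n : ℕ))))

/-- `(1 - q^{6n-1}) (1/q, ρ₁, ρ₂, q/(ρ₁ρ₂); q³)_n (q³; q³)_{2n-1} q^{2n}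
  / ((1 - 1/q) (q²/ρ₁, q²/ρ₂, ρ₁ρ₂ q, q³; q³)_n (q; q³)_{2n})`. -/
noncomputable def seriesThreeSnd (q ρ₁ ρ₂ : ℂ) (n : ℕ+) : ℂ :=
  (1 - q ^ (6 * (n : ℕ) - 1))
      * (qPoch (1 / q) (q ^ 3) n * qPoch ρ₁ (q ^ 3) n * qPoch ρ₂ (q ^ 3) n
        * qPoch (q / (ρ₁ * ρ₂)) (q ^ 3) n)
      * qPoch (q ^ 3) (q ^ 3) (2 * (n : ℕ) - 1) * q ^ (2 * (n : ℕ))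
    / ((1 - 1 / q)
      * (qPoch (q ^ 2 / ρ₁) (q ^ 3) n * qPoch (q ^ 2 / ρ₂) (q ^ 3) n
        * qPoch (ρ₁ * ρ₂ * q) (q ^ 3) n * qPoch (q ^ 3) (q ^ 3) n)
      * qPoch q (q ^ 3) (2 * (n : ℕ)))

/-- `(-1)^n q^{(3n²+n)/2} / (1 - q^{3n})`; the exponent `(3n²+n)/2` is an integer. -/
noncomputable def seriesFourFst (q : ℂ) (n : ℕ+) : ℂ :=
  (-1) ^ (n : ℕ) * q ^ ((3 * (n : ℕ) ^ 2 + n) / 2) / (1 - q ^ (3 * (n : ℕ)))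

/-- `(1 - q^{6n-1}) (1/q; q³)_n (q³; q³)_{2n-1} (-1)^n q^{(3n²-n)/2}
  / ((1 - 1/q) (q³; q³)_n (q; q³)_{2n})`; the exponent `(3n²-n)/2` is a natural number. -/
noncomputable def seriesFourSnd (q : ℂ) (n : ℕ+) : ℂ :=
  (1 - q ^ (6 * (n : ℕ) - 1)) * qPoch (1 / q) (q ^ 3) n
      * qPoch (q ^ 3) (q ^ 3) (2 * (n : ℕ) - 1) * (-1) ^ (n : ℕ) * q ^ ((3 * (n : ℕ) ^ 2 - n) / 2)
    / ((1 - 1 / q) * qPoch (q ^ 3) (q ^ 3) n * qPoch q (q ^ 3) (2 * (n : ℕ)))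

open Filter Topology Finset

/-! Everything rests on the Lambert series a(q) = 1 + 6 ∑_{i≥0} (q^{3i+1}/(1-q^{3i+1}) -
q^{3i+2}/(1-q^{3i+2})), which is `cubicTheta_eq_lambert`. Cube Jacobi's theta series θ(q; z) = ∑
(-1)^n q^{n(n-1)/2} z^n: the coefficient of z⁰ is a(q), and sorting the powers of z modulo 3 writes
θ(q; z)³ through θ(q³; ·) with just one further unknown constant (`thetaSum_pow_three`). Putting z
equal to a primitive cube root of unity determines that constant. At z = 1 the cube vanishes to
third order, so the derivative of the other side is zero there; by the triple product this
derivative is explicit, and the equation can be solved for a(q).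

The first representation is this Lambert series rewritten: a degenerate Gauss series loses exactly
one Lambert term when z is replaced by zp (`tsum_gaussLogTerm_step`), here with p = q³ and z = q.

The third and fourth come from one double series ∑ q^{m+j} V_m K(m,j), with V = `poisedFactor` and K
= `baileyKernel`. Its diagonals m + j = n are terminating very-well-poised sums of Jackson's type
and give the first series of the representation; its rows m ≥ 1 are summed by the q-Gauss theorem
and give the second; row 0 does not depend on V and is the series of the first representation, apart
from the corner term (`poised_transformation`). The second representation is the third at ρ₁ = 1/q,
ρ₂ = q. The fourth is its formal limit ρ₁, ρ₂ → ∞, reached without a limit because V depends on the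
parameters only through ratios of cubics whose coefficients are linear in (e₀, e₁, f₂). -/

/-! ### Finite and infinite q-shifted factorials: convergence and uniform bounds. -/

theorem qPoch_zero (a q : ℂ) : qPoch a q 0 = 1 := by simp [qPoch]

theorem qPoch_succ (a q : ℂ) (n : ℕ) : qPoch a q (n + 1) = qPoch a q n * (1 - a * q ^ n) := by
  simp [qPoch, prod_range_succ]

theorem qPoch_add (a q : ℂ) (m n : ℕ) :
    qPoch a q (m + n) = qPoch a q m * qPoch (a * q ^ m) q n := by
  simp only [qPoch, prod_range_add]
  congr 1
  exact prod_congr rfl fun i _ => by rw [pow_add]; ring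

theorem qPoch_ne_zero {a q : ℂ} (h : ∀ i : ℕ, 1 - a * q ^ i ≠ 0) (n : ℕ) : qPoch a q n ≠ 0 :=
  prod_ne_zero_iff.2 fun i _ => h i

/-- The infinite `q`-shifted factorial `(a; q)_∞`. -/
noncomputable def qPochInf (a q : ℂ) : ℂ := ∏' i : ℕ, (1 - a * q ^ i)

theorem summable_norm_mul_pow (a : ℂ) {q : ℂ} (hq : ‖q‖ < 1) :
    Summable fun i : ℕ => ‖a * q ^ i‖ := by
  simp only [norm_mul, norm_pow]
  exact (summable_geometric_of_lt_one (norm_nonneg _) hq).mul_left _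

theorem multipliable_one_sub_mul_pow (a : ℂ) {q : ℂ} (hq : ‖q‖ < 1) :
    Multipliable fun i : ℕ => 1 - a * q ^ i := by
  simpa [sub_eq_add_neg] using
    multipliable_one_add_of_summable (f := fun i : ℕ => -(a * q ^ i))
      (by simpa using summable_norm_mul_pow a hq)

theorem tendsto_qPoch (a : ℂ) {q : ℂ} (hq : ‖q‖ < 1) :
    Tendsto (qPoch a q) atTop (𝓝 (qPochInf a q)) :=
  (multipliable_one_sub_mul_pow a hq).hasProd.tendsto_prod_nat

theorem qPochInf_ne_zero {a q : ℂ} (hq : ‖q‖ < 1) (h : ∀ i : ℕ, 1 - a * q ^ i ≠ 0) :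
    qPochInf a q ≠ 0 := by
  have := tprod_one_add_ne_zero_of_summable (f := fun i : ℕ => -(a * q ^ i))
    (by simpa [sub_eq_add_neg] using h) (by simpa using summable_norm_mul_pow a hq)
  simpa [qPochInf, sub_eq_add_neg] using this

theorem qPochInf_eq_mul (a : ℂ) {q : ℂ} (hq : ‖q‖ < 1) (n : ℕ) :
    qPochInf a q = qPoch a q n * qPochInf (a * q ^ n) q := by
  refine tendsto_nhds_unique ((tendsto_add_atTop_iff_nat n).2 (tendsto_qPoch a hq)) ?_
  refine ((tendsto_qPoch (a * q ^ n) hq).const_mul (qPoch a q n)).congr fun m => ?_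
  rw [← qPoch_add, add_comm]

theorem one_sub_mul_pow_ne_zero {a q : ℂ} (ha : ‖a‖ < 1) (hq : ‖q‖ ≤ 1) (i : ℕ) :
    1 - a * q ^ i ≠ 0 := by
  intro h
  have h1 : ‖a * q ^ i‖ = 1 := by rw [← sub_eq_zero.1 h, norm_one]
  rw [norm_mul, norm_pow] at h1
  nlinarith [pow_le_one₀ (n := i) (norm_nonneg q) hq, norm_nonneg a,
    pow_nonneg (norm_nonneg q) i]

theorem exists_norm_qPoch_le (a : ℂ) {q : ℂ} (hq : ‖q‖ < 1) :
    ∃ C : ℝ, 0 < C ∧ ∀ n, ‖qPoch a q n‖ ≤ C := by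
  obtain ⟨C, hC⟩ := (Metric.isBounded_range_of_tendsto _ (tendsto_qPoch a hq)).exists_norm_le
  exact ⟨max C 1, by positivity, fun n => (hC _ ⟨n, rfl⟩).trans (le_max_left _ _)⟩

theorem exists_norm_inv_qPoch_le {a q : ℂ} (hq : ‖q‖ < 1) (h : ∀ i : ℕ, 1 - a * q ^ i ≠ 0) :
    ∃ C : ℝ, 0 < C ∧ ∀ n, ‖(qPoch a q n)⁻¹‖ ≤ C := by
  obtain ⟨C, hC⟩ := (Metric.isBounded_range_of_tendsto _
    ((tendsto_qPoch a hq).inv₀ (qPochInf_ne_zero hq h))).exists_norm_le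
  exact ⟨max C 1, by positivity, fun n => (hC _ ⟨n, rfl⟩).trans (le_max_left _ _)⟩

/-- Telescoping summation. -/
theorem hasSum_of_telescoping {f g : ℕ → ℂ} (hf : Summable f) (h : ∀ n, f n = g n - g (n + 1))
    (hg : Tendsto g atTop (𝓝 0)) : HasSum f (g 0) := by
  refine (hf.hasSum_iff_tendsto_nat).2 ?_
  have : ∀ n, ∑ i ∈ range n, f i = g 0 - g n := fun n => by
    rw [sum_congr rfl fun i _ => h i, sum_range_sub']
  simp only [this]
  simpa using hg.const_sub (g 0)

/-! ### The q-Gauss summation and its degenerate case as a Lambert series. -/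

section Gauss

variable {p : ℂ}

theorem qPoch_mul_succ_div (c : ℂ) (hc : ∀ i : ℕ, 1 - c * p ^ i ≠ 0) (j : ℕ) :
    (qPoch (c * p) p j)⁻¹ = (1 - c) * (qPoch c p j)⁻¹ / (1 - c * p ^ j) := by
  have h1 : qPoch c p (j + 1) = (1 - c) * qPoch (c * p) p j := by
    rw [add_comm, qPoch_add]; simp [qPoch]
  have h0 : 1 - c ≠ 0 := by simpa using hc 0
  have h2 := qPoch_succ c p j
  have h3 := qPoch_ne_zero hc j
  have h4 := qPoch_ne_zero hc (j + 1)
  have h5 : qPoch (c * p) p j ≠ 0 := fun h => h4 (by rw [h1, h, mul_zero])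
  have h6 := hc j
  field_simp
  linear_combination h1 - h2

/-- The general term of the `q`-analogue of Gauss's series. -/
noncomputable def gaussTerm (a b c z p : ℂ) (j : ℕ) : ℂ :=
  qPoch a p j * qPoch b p j * (qPoch p p j)⁻¹ * (qPoch c p j)⁻¹ * z ^ j

theorem exists_norm_gaussTerm_le (a b : ℂ) {c : ℂ} (hp : ‖p‖ < 1)
    (hc : ∀ i : ℕ, 1 - c * p ^ i ≠ 0) :
    ∃ C : ℝ, 0 < C ∧ ∀ z j, ‖gaussTerm a b c z p j‖ ≤ C * ‖z‖ ^ j := by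
  obtain ⟨A, hA, hA'⟩ := exists_norm_qPoch_le a hp
  obtain ⟨B, hB, hB'⟩ := exists_norm_qPoch_le b hp
  obtain ⟨D, hD, hD'⟩ := exists_norm_inv_qPoch_le hp (one_sub_mul_pow_ne_zero hp hp.le)
  obtain ⟨E, hE, hE'⟩ := exists_norm_inv_qPoch_le hp hc
  refine ⟨A * B * D * E, by positivity, fun z j => ?_⟩
  simp only [gaussTerm, norm_mul, norm_pow]
  gcongr
  exacts [hA' j, hB' j, hD' j, hE' j]

/-- A contiguous relation for (z, c) ↦ (zp, cp) with c = zab. The certificate is (1 - p^j) times the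
summand itself; it vanishes at j = 0, so summation over j leaves no boundary term there. -/
theorem gaussTerm_telescope (a b z : ℂ) (hp : ‖p‖ < 1)
    (hc : ∀ i : ℕ, 1 - z * a * b * p ^ i ≠ 0) (j : ℕ) :
    (1 - z) * gaussTerm a b (z * a * b) z p j
      - (1 - z * a) * (1 - z * b) / (1 - z * a * b)
        * gaussTerm a b (z * a * b * p) (z * p) p j
      = (1 - p ^ j) * gaussTerm a b (z * a * b) z p j
        - (1 - p ^ (j + 1)) * gaussTerm a b (z * a * b) z p (j + 1) := by
  have h0 : 1 - z * a * b ≠ 0 := by simpa using hc 0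
  have h1 := hc j
  have h2 : 1 - p * p ^ j ≠ 0 := one_sub_mul_pow_ne_zero hp hp.le j
  simp only [gaussTerm, qPoch_mul_succ_div _ hc, qPoch_succ, mul_inv, mul_pow, pow_succ]
  rw [mul_comm (p ^ j) p]
  generalize qPoch a p j = A, qPoch b p j = B, (qPoch p p j)⁻¹ = C, (qPoch (z * a * b) p j)⁻¹ = D,
    p ^ j = x, z ^ j = y at *
  have h3 : 1 - x * p ≠ 0 := by rwa [mul_comm]
  field_simp
  ring

theorem gaussTerm_summable (a b : ℂ) {c z : ℂ} (hp : ‖p‖ < 1)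
    (hc : ∀ i : ℕ, 1 - c * p ^ i ≠ 0) (hz : ‖z‖ < 1) : Summable (gaussTerm a b c z p) := by
  obtain ⟨C, -, hC⟩ := exists_norm_gaussTerm_le a b hp hc
  exact .of_norm_bounded ((summable_geometric_of_lt_one (norm_nonneg _) hz).mul_left C) (hC z)

theorem tsum_gaussTerm_step (a b z : ℂ) (hp : ‖p‖ < 1)
    (hc : ∀ i : ℕ, 1 - z * a * b * p ^ i ≠ 0) (hz : ‖z‖ < 1) :
    (1 - z) * (1 - z * a * b) * ∑' j, gaussTerm a b (z * a * b) z p j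
      = (1 - z * a) * (1 - z * b) * ∑' j, gaussTerm a b (z * a * b * p) (z * p) p j := by
  have h0 : 1 - z * a * b ≠ 0 := by simpa using hc 0
  have hc' : ∀ i : ℕ, 1 - z * a * b * p * p ^ i ≠ 0 := fun i => by
    have := hc (i + 1); rwa [pow_succ', ← mul_assoc] at this
  have hz' : ‖z * p‖ < 1 := by
    rw [norm_mul]; nlinarith [norm_nonneg z, norm_nonneg p]
  have s1 := gaussTerm_summable a b hp hc hz
  have s2 := gaussTerm_summable a b hp hc' hz'
  have key := hasSum_of_telescoping
    ((s1.mul_left (1 - z)).sub (s2.mul_left ((1 - z * a) * (1 - z * b) / (1 - z * a * b))))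
    (g := fun j => (1 - p ^ j) * gaussTerm a b (z * a * b) z p j)
    (gaussTerm_telescope a b z hp hc) ?_
  · have := key.unique ((s1.hasSum.mul_left (1 - z)).sub
      (s2.hasSum.mul_left ((1 - z * a) * (1 - z * b) / (1 - z * a * b))))
    simp only [pow_zero, sub_self, zero_mul] at this
    field_simp at this
    linear_combination -this
  · simpa using ((tendsto_pow_atTop_nhds_zero_of_norm_lt_one hp).const_sub 1).mul
      s1.tendsto_atTop_zero

/-- The uniformity in the shift n is what dominated convergence needs when c is pushed to c pⁿ. -/
theorem exists_norm_inv_qPoch_shift_le {c : ℂ} (hp : ‖p‖ < 1)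
    (hc : ∀ i : ℕ, 1 - c * p ^ i ≠ 0) :
    ∃ C : ℝ, 0 < C ∧ ∀ n j, ‖(qPoch (c * p ^ n) p j)⁻¹‖ ≤ C := by
  obtain ⟨A, hA, hA'⟩ := exists_norm_qPoch_le c hp
  obtain ⟨B, hB, hB'⟩ := exists_norm_inv_qPoch_le hp hc
  refine ⟨A * B, by positivity, fun n j => ?_⟩
  have h : (qPoch (c * p ^ n) p j)⁻¹ = qPoch c p n * (qPoch c p (n + j))⁻¹ := by
    rw [qPoch_add, mul_inv, mul_inv_cancel_left₀ (qPoch_ne_zero hc n)]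
  rw [h, norm_mul]
  gcongr
  exacts [hA' n, hB' _]

theorem tendsto_tsum_gaussTerm (a b : ℂ) {c z : ℂ} (hp : ‖p‖ < 1)
    (hc : ∀ i : ℕ, 1 - c * p ^ i ≠ 0) (hz : ‖z‖ < 1) :
    Tendsto (fun n : ℕ => ∑' j, gaussTerm a b (c * p ^ n) (z * p ^ n) p j) atTop (𝓝 1) := by
  obtain ⟨A, hA, hA'⟩ := exists_norm_qPoch_le a hp
  obtain ⟨B, hB, hB'⟩ := exists_norm_qPoch_le b hp
  obtain ⟨D, hD, hD'⟩ := exists_norm_inv_qPoch_le hp (one_sub_mul_pow_ne_zero hp hp.le)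
  obtain ⟨E, hE, hE'⟩ := exists_norm_inv_qPoch_shift_le hp hc
  have bd : ∀ n j : ℕ, ‖gaussTerm a b (c * p ^ n) (z * p ^ n) p j‖
      ≤ A * B * D * E * (‖z‖ * ‖p‖ ^ n) ^ j := fun n j => by
    simp only [gaussTerm, norm_mul, norm_pow]
    gcongr
    exacts [hA' j, hB' j, hD' j, hE' n j]
  -- As zpⁿ → 0 only the term j = 0 survives.
  have hlim : ∑' j : ℕ, (if j = 0 then (1 : ℂ) else 0) = 1 := by simp
  rw [← hlim]
  refine tendsto_tsum_of_dominated_convergence (bound := fun j => A * B * D * E * ‖z‖ ^ j)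
    ((summable_geometric_of_lt_one (norm_nonneg _) hz).mul_left _) (fun j => ?_)
    (.of_forall fun n j => (bd n j).trans ?_)
  · rcases eq_or_ne j 0 with rfl | hj
    · simp [gaussTerm, qPoch_zero]
    · rw [if_neg hj]
      refine squeeze_zero_norm (fun n => bd n j) ?_
      have := ((tendsto_pow_atTop_nhds_zero_of_lt_one (norm_nonneg p) hp).const_mul ‖z‖).pow j
      simpa [hj] using this.const_mul (A * B * D * E)
  · gcongr
    exact mul_le_of_le_one_right (norm_nonneg _) (pow_le_one₀ (norm_nonneg _) hp.le)

theorem norm_mul_pow_lt_one {z : ℂ} (hz : ‖z‖ < 1) (hp : ‖p‖ < 1) (n : ℕ) : ‖z * p ^ n‖ < 1 := by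
  rw [norm_mul, norm_pow]
  exact (mul_le_of_le_one_right (norm_nonneg _) (pow_le_one₀ (norm_nonneg _) hp.le)).trans_lt hz

theorem tsum_gaussTerm_iterate (a b z : ℂ) (hp : ‖p‖ < 1)
    (hc : ∀ i : ℕ, 1 - z * a * b * p ^ i ≠ 0) (hz : ‖z‖ < 1) (n : ℕ) :
    qPoch z p n * qPoch (z * a * b) p n * ∑' j, gaussTerm a b (z * a * b) z p j
      = qPoch (z * a) p n * qPoch (z * b) p n
        * ∑' j, gaussTerm a b (z * a * b * p ^ n) (z * p ^ n) p j := by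
  induction n with
  | zero => simp [qPoch_zero]
  | succ n ih =>
    have h := tsum_gaussTerm_step a b (z * p ^ n) hp (fun i => by
      have := hc (n + i)
      rw [pow_add] at this
      convert this using 2
      ring) (norm_mul_pow_lt_one hz hp n)
    have e : z * p ^ n * a * b = z * a * b * p ^ n := by ring
    rw [e] at h
    simp only [qPoch_succ, pow_succ, ← mul_assoc]
    generalize ∑' j, gaussTerm a b (z * a * b * p ^ n * p) (z * p ^ n * p) p j = X at *
    linear_combination (1 - z * p ^ n) * (1 - z * a * b * p ^ n) * ih
      + qPoch (z * a) p n * qPoch (z * b) p n * h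

/-- The `q`-analogue of Gauss's summation. -/
theorem tsum_gaussTerm (a b z : ℂ) (hp : ‖p‖ < 1)
    (hc : ∀ i : ℕ, 1 - z * a * b * p ^ i ≠ 0) (hz : ‖z‖ < 1) :
    ∑' j, gaussTerm a b (z * a * b) z p j
      = qPochInf (z * a) p * qPochInf (z * b) p / (qPochInf z p * qPochInf (z * a * b) p) := by
  rw [eq_div_iff (mul_ne_zero
    (qPochInf_ne_zero hp (one_sub_mul_pow_ne_zero hz hp.le)) (qPochInf_ne_zero hp hc)), mul_comm]
  refine tendsto_nhds_unique (((tendsto_qPoch z hp).mul (tendsto_qPoch _ hp)).mul_const _) ?_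
  simp only [tsum_gaussTerm_iterate a b z hp hc hz]
  simpa using ((tendsto_qPoch (z * a) hp).mul (tendsto_qPoch (z * b) hp)).mul
    (tendsto_tsum_gaussTerm a b hp hc hz)

/-- The term of the logarithmic derivative of Gauss's series at `a = 1`, with index shifted. -/
noncomputable def gaussLogTerm (b c z p : ℂ) (j : ℕ) : ℂ :=
  qPoch b p (j + 1) * (qPoch c p (j + 1))⁻¹ * z ^ (j + 1) / (1 - p ^ (j + 1))

theorem one_sub_pow_succ_ne_zero (hp : ‖p‖ < 1) (j : ℕ) : 1 - p ^ (j + 1) ≠ 0 := by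
  rw [pow_succ']; exact one_sub_mul_pow_ne_zero hp hp.le j

theorem exists_norm_gaussLogTerm_le (b : ℂ) {c : ℂ} (hp : ‖p‖ < 1)
    (hc : ∀ i : ℕ, 1 - c * p ^ i ≠ 0) :
    ∃ C : ℝ, 0 < C ∧ ∀ (z : ℂ) (n j : ℕ), ‖gaussLogTerm b (c * p ^ n) z p j‖
      ≤ C * ‖z‖ ^ (j + 1) := by
  obtain ⟨A, hA, hA'⟩ := exists_norm_qPoch_le b hp
  obtain ⟨E, hE, hE'⟩ := exists_norm_inv_qPoch_shift_le hp hc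
  have hp1 : 0 < 1 - ‖p‖ := by linarith
  refine ⟨A * E / (1 - ‖p‖), by positivity, fun z n j => ?_⟩
  have h1 : 1 - ‖p‖ ≤ ‖1 - p ^ (j + 1)‖ := by
    have h2 := norm_sub_norm_le (1 : ℂ) (p ^ (j + 1))
    have h3 : ‖p‖ ^ (j + 1) ≤ ‖p‖ := by
      simpa using pow_le_pow_of_le_one (norm_nonneg p) hp.le (Nat.le_add_left 1 j)
    rw [norm_one, norm_pow] at h2
    linarith
  simp only [gaussLogTerm, norm_mul, norm_pow, norm_div]
  rw [div_mul_eq_mul_div]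
  gcongr
  exacts [hA' _, hE' n _]

theorem summable_gaussLogTerm (b : ℂ) {c z : ℂ} (hp : ‖p‖ < 1)
    (hc : ∀ i : ℕ, 1 - c * p ^ i ≠ 0) (hz : ‖z‖ < 1) : Summable (gaussLogTerm b c z p) := by
  obtain ⟨C, -, hC⟩ := exists_norm_gaussLogTerm_le b hp hc
  refine .of_norm_bounded (((summable_nat_add_iff 1).2
    (summable_geometric_of_lt_one (norm_nonneg _) hz)).mul_left C) fun j => ?_
  simpa using hC z 0 j

/-- The analogue of the contiguous relation at a = 1. Here the certificate does not vanish at the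
lower end, and its value there is the Lambert term z/(1-z) - zb/(1-zb). -/
theorem gaussLogTerm_telescope (b z : ℂ) (hp : ‖p‖ < 1) (hz : ‖z‖ < 1)
    (hc : ∀ i : ℕ, 1 - z * b * p ^ i ≠ 0) (j : ℕ) :
    gaussLogTerm b (z * b) z p j - gaussLogTerm b (z * b * p) (z * p) p j
      = qPoch b p (j + 1) * (qPoch (z * b) p (j + 1))⁻¹ * z ^ (j + 1) / (1 - z)
        - qPoch b p (j + 2) * (qPoch (z * b) p (j + 2))⁻¹ * z ^ (j + 2) / (1 - z) := by
  have hz0 : 1 - z ≠ 0 := by simpa using one_sub_mul_pow_ne_zero hz hp.le 0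
  have h1 := hc (j + 1)
  have h2 := one_sub_pow_succ_ne_zero hp j
  rw [gaussLogTerm, gaussLogTerm, qPoch_mul_succ_div _ hc, qPoch_succ _ _ (j + 1),
    qPoch_succ _ _ (j + 1), mul_inv, mul_pow, pow_succ z (j + 1)]
  generalize qPoch b p (j + 1) = A, (qPoch (z * b) p (j + 1))⁻¹ = D,
    p ^ (j + 1) = x, z ^ (j + 1) = y at *
  have h3 : 1 - x * z * b ≠ 0 := by convert h1 using 2; ring
  field_simp
  ring

theorem tsum_gaussLogTerm_step (b z : ℂ) (hp : ‖p‖ < 1) (hz : ‖z‖ < 1)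
    (hc : ∀ i : ℕ, 1 - z * b * p ^ i ≠ 0) :
    ∑' j, gaussLogTerm b (z * b) z p j
      = z / (1 - z) - z * b / (1 - z * b)
        + ∑' j, gaussLogTerm b (z * b * p) (z * p) p j := by
  have hz0 : 1 - z ≠ 0 := by simpa using one_sub_mul_pow_ne_zero hz hp.le 0
  have h0 : 1 - z * b ≠ 0 := by simpa using hc 0
  have hc' : ∀ i : ℕ, 1 - z * b * p * p ^ i ≠ 0 := fun i => by
    have := hc (i + 1); rwa [pow_succ', ← mul_assoc] at this
  have s1 := summable_gaussLogTerm b hp hc hz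
  have s2 := summable_gaussLogTerm b hp hc' (by simpa only [pow_one] using norm_mul_pow_lt_one hz hp 1)
  obtain ⟨A, hA, hA'⟩ := exists_norm_qPoch_le b hp
  obtain ⟨E, hE, hE'⟩ := exists_norm_inv_qPoch_le hp hc
  have key := hasSum_of_telescoping (s1.sub s2) (gaussLogTerm_telescope b z hp hz hc) ?_
  · have h := key.unique (s1.hasSum.sub s2.hasSum)
    have h1 : qPoch b p (0 + 1) * (qPoch (z * b) p (0 + 1))⁻¹ * z ^ (0 + 1) / (1 - z)
        = z / (1 - z) - z * b / (1 - z * b) := by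
      simp only [qPoch, zero_add, range_one, prod_singleton, pow_zero, mul_one, pow_one]
      have h0' : 1 - b * z ≠ 0 := by rwa [mul_comm]
      field_simp
      ring
    linear_combination h1 - h
  · refine squeeze_zero_norm (a := fun j => A * E * ‖z‖ ^ (j + 1) / ‖1 - z‖) (fun j => ?_) ?_
    · simp only [norm_mul, norm_pow, norm_div]
      gcongr
      exacts [hA' _, hE' _]
    · simpa using (((tendsto_add_atTop_iff_nat 1).2
        (tendsto_pow_atTop_nhds_zero_of_lt_one (norm_nonneg z) hz)).const_mul
          (A * E)).div_const ‖1 - z‖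

theorem tendsto_sum_lambert (b z : ℂ) (hp : ‖p‖ < 1) (hz : ‖z‖ < 1)
    (hc : ∀ i : ℕ, 1 - z * b * p ^ i ≠ 0) :
    Tendsto (fun n => ∑ i ∈ range n,
      (z * p ^ i / (1 - z * p ^ i) - z * b * p ^ i / (1 - z * b * p ^ i)))
      atTop (𝓝 (∑' j, gaussLogTerm b (z * b) z p j)) := by
  have key : ∀ n, ∑ i ∈ range n,
      (z * p ^ i / (1 - z * p ^ i) - z * b * p ^ i / (1 - z * b * p ^ i))
      = ∑' j, gaussLogTerm b (z * b) z p j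
        - ∑' j, gaussLogTerm b (z * b * p ^ n) (z * p ^ n) p j := fun n => by
    induction n with
    | zero => simp
    | succ n ih =>
      have h := tsum_gaussLogTerm_step b (z * p ^ n) hp (norm_mul_pow_lt_one hz hp n) (fun i => by
        have := hc (n + i)
        rw [pow_add] at this
        convert this using 2
        ring)
      have e : z * p ^ n * b = z * b * p ^ n := by ring
      rw [e] at h
      rw [sum_range_succ, ih, h, pow_succ, ← mul_assoc, ← mul_assoc]
      ring
  simp only [key]
  obtain ⟨C, hC, hC'⟩ := exists_norm_gaussLogTerm_le b hp hc
  have hlim : Tendsto (fun n : ℕ => ∑' j, gaussLogTerm b (z * b * p ^ n) (z * p ^ n) p j) atTop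
      (𝓝 (∑' _ : ℕ, 0)) := by
    have hb : ∀ n : ℕ, ‖z * p ^ n‖ ≤ ‖z‖ := fun n => by
      rw [norm_mul, norm_pow]
      exact mul_le_of_le_one_right (norm_nonneg _) (pow_le_one₀ (norm_nonneg _) hp.le)
    refine tendsto_tsum_of_dominated_convergence (bound := fun j => C * ‖z‖ ^ (j + 1))
      (((summable_nat_add_iff 1).2
        (summable_geometric_of_lt_one (norm_nonneg _) hz)).mul_left _) (fun j => ?_)
      (.of_forall fun n j => (hC' (z * p ^ n) n j).trans (by gcongr; exact hb n))
    refine squeeze_zero_norm (fun n => hC' (z * p ^ n) n j) ?_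
    have := (((tendsto_pow_atTop_nhds_zero_of_norm_lt_one hp).const_mul z).norm.pow (j + 1))
    simpa using this.const_mul C
  simpa using hlim.const_sub (∑' j, gaussLogTerm b (z * b) z p j)

end Gauss

/-! ### A terminating very-well-poised sum of Jackson's type, by creative telescoping. -/

section Terminating

/-- The cubic `(1 - d₁ N)(1 - d₂ N)(1 - d₃ N)` with `d₁ d₂ d₃ = q⁵`, up to a scalar. -/
def denCubic (q e₀ e₁ f₂ N : ℂ) : ℂ := e₀ - e₁ * N + q ^ 2 * f₂ * N ^ 2 - q ^ 5 * e₀ * N ^ 3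

/-- The cubic `(1 - q³ N / d₁)(1 - q³ N / d₂)(1 - q³ N / d₃)` with `d₁ d₂ d₃ = q⁵`,
up to a scalar. -/
def numCubic (q e₀ e₁ f₂ N : ℂ) : ℂ := e₀ - f₂ * N + q * e₁ * N ^ 2 - q ^ 4 * e₀ * N ^ 3

/-- The part of the very-well-poised factor not containing `1 - q ^ (6 m - 1)`. -/
noncomputable def poisedCore (q e₀ e₁ f₂ : ℂ) (m : ℕ) : ℂ :=
  qPoch (1 / q) (q ^ 3) m / ((1 - 1 / q) * qPoch (q ^ 3) (q ^ 3) m) *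
    ∏ i ∈ range m, numCubic q e₀ e₁ f₂ ((q ^ 3) ^ i / q) / denCubic q e₀ e₁ f₂ ((q ^ 3) ^ i)

/-- The very-well-poised factor. -/
noncomputable def poisedFactor (q e₀ e₁ f₂ : ℂ) (m : ℕ) : ℂ :=
  (1 - ((q ^ 3) ^ m) ^ 2 / q) * poisedCore q e₀ e₁ f₂ m

/-- The kernel of the Bailey-type inversion, indexed by `m` and `n - m`. -/
noncomputable def baileyKernel (q : ℂ) (m j : ℕ) : ℂ :=
  q ^ m * (qPoch q (q ^ 3) j * qPoch (q ^ 3) (q ^ 3) (2 * m + j - 1)) /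
    (qPoch (q ^ 3) (q ^ 3) j * qPoch (q ^ 2) (q ^ 3) (2 * m + j))

variable {q : ℂ}

theorem one_sub_pow_ne_zero (hq1 : ‖q‖ < 1) {n : ℕ} (hn : n ≠ 0) : 1 - q ^ n ≠ 0 := by
  obtain ⟨k, rfl⟩ := Nat.exists_eq_succ_of_ne_zero hn
  exact one_sub_pow_succ_ne_zero hq1 k

theorem one_sub_pow_mul_ne_zero (hq1 : ‖q‖ < 1) {n : ℕ} (hn : n ≠ 0) (i : ℕ) :
    1 - q ^ n * (q ^ 3) ^ i ≠ 0 := by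
  rw [← pow_mul, ← pow_add]; exact one_sub_pow_ne_zero hq1 (by omega)

theorem one_sub_mul_cube_pow_ne_zero (hq1 : ‖q‖ < 1) (i : ℕ) : 1 - q * (q ^ 3) ^ i ≠ 0 := by
  simpa using one_sub_pow_mul_ne_zero hq1 one_ne_zero i

theorem norm_cube_lt_one (hq1 : ‖q‖ < 1) : ‖q ^ 3‖ < 1 := by
  rw [norm_pow]; exact pow_lt_one₀ (norm_nonneg _) hq1 (by norm_num)

theorem one_sub_inv_ne_zero (hq0 : q ≠ 0) (hq1 : ‖q‖ < 1) : 1 - 1 / q ≠ 0 := by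
  intro h
  have : q = 1 := by field_simp at h; linear_combination h
  simp [this] at hq1

theorem poisedCore_succ (hq0 : q ≠ 0) (hq1 : ‖q‖ < 1) {e₀ e₁ f₂ : ℂ}
    (hU : ∀ i : ℕ, denCubic q e₀ e₁ f₂ ((q ^ 3) ^ i) ≠ 0) (m : ℕ) :
    poisedCore q e₀ e₁ f₂ (m + 1) * (1 - q ^ 3 * (q ^ 3) ^ m) * denCubic q e₀ e₁ f₂ ((q ^ 3) ^ m)
      = poisedCore q e₀ e₁ f₂ m * (1 - (q ^ 3) ^ m / q)
        * numCubic q e₀ e₁ f₂ ((q ^ 3) ^ m / q) := by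
  have h1 := one_sub_pow_mul_ne_zero hq1 three_ne_zero m
  have h2 := qPoch_ne_zero (one_sub_pow_mul_ne_zero hq1 three_ne_zero) m
  have h3 := hU m
  have h4 := one_sub_inv_ne_zero hq0 hq1
  rw [poisedCore, poisedCore, qPoch_succ, qPoch_succ, prod_range_succ]
  generalize ∏ i ∈ range m, numCubic q e₀ e₁ f₂ ((q ^ 3) ^ i / q)
    / denCubic q e₀ e₁ f₂ ((q ^ 3) ^ i) = A
  generalize qPoch (1 / q) (q ^ 3) m = B, qPoch (q ^ 3) (q ^ 3) m = C,
    numCubic q e₀ e₁ f₂ ((q ^ 3) ^ m / q) = D, denCubic q e₀ e₁ f₂ ((q ^ 3) ^ m) = E,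
    1 - q ^ 3 * (q ^ 3) ^ m = F, 1 - 1 / q = G at *
  field_simp

/-- The rational function certificate for the terminating very-well-poised summation. -/
noncomputable def baileyCertificate (q e₀ e₁ f₂ : ℂ) (m j : ℕ) : ℂ :=
  -(q ^ 3) ^ j * (1 - (q ^ 3) ^ m) * (1 - ((q ^ 3) ^ m * (q ^ 3) ^ j) ^ 2 / q ^ 3)
    * denCubic q e₀ e₁ f₂ ((q ^ 3) ^ m / q ^ 3) * poisedCore q e₀ e₁ f₂ m
    * (q ^ m * (qPoch q (q ^ 3) j * qPoch (q ^ 3) (q ^ 3) (2 * m + j - 2)) /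
      (qPoch (q ^ 3) (q ^ 3) j * qPoch (q ^ 2) (q ^ 3) (2 * m + j - 1)))

/-- Creative telescoping: the first-order recurrence in n satisfied by the closed form is applied to
the summand with n = m + j, and the defect is a difference in m along the diagonal. The case m = j =
0 is excluded because 2m + j - 1 would be truncated. -/
theorem bailey_telescope (hq0 : q ≠ 0) (hq1 : ‖q‖ < 1) {e₀ e₁ f₂ : ℂ}
    (hU : ∀ i : ℕ, denCubic q e₀ e₁ f₂ ((q ^ 3) ^ i) ≠ 0) (m j : ℕ) (hmj : m + j ≠ 0) :
    (1 - (q ^ 3) ^ (m + j + 1)) * denCubic q e₀ e₁ f₂ ((q ^ 3) ^ (m + j))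
        * (poisedFactor q e₀ e₁ f₂ m * baileyKernel q m (j + 1))
      - (1 - (q ^ 3) ^ (m + j)) * numCubic q e₀ e₁ f₂ ((q ^ 3) ^ (m + j))
        * (poisedFactor q e₀ e₁ f₂ m * baileyKernel q m j)
      = baileyCertificate q e₀ e₁ f₂ (m + 1) j - baileyCertificate q e₀ e₁ f₂ m (j + 1) := by
  obtain ⟨r, hr⟩ := Nat.exists_eq_succ_of_ne_zero (show 2 * m + j ≠ 0 by omega)
  have hr' : (q ^ 3) ^ (r + 1) = ((q ^ 3) ^ m) ^ 2 * (q ^ 3) ^ j := by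
    rw [← Nat.succ_eq_add_one, ← hr, pow_add, pow_mul']
  have hc := poisedCore_succ hq0 hq1 hU m
  have hr2 : q ^ 3 * (q ^ 3) ^ r = ((q ^ 3) ^ m) ^ 2 * (q ^ 3) ^ j := by
    rw [← hr', pow_succ (q ^ 3) r, mul_comm]
  have hdiv : (q ^ 3) ^ m * q ^ 3 / q ^ 3 = (q ^ 3) ^ m := by field_simp
  have k1 : baileyKernel q m (j + 1) = q ^ m * (qPoch q (q ^ 3) j * (1 - q * (q ^ 3) ^ j)
      * (qPoch (q ^ 3) (q ^ 3) r * (1 - ((q ^ 3) ^ m) ^ 2 * (q ^ 3) ^ j)))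
      / (qPoch (q ^ 3) (q ^ 3) j * (1 - q ^ 3 * (q ^ 3) ^ j)
        * (qPoch (q ^ 2) (q ^ 3) (r + 1)
          * (1 - q ^ 2 * (((q ^ 3) ^ m) ^ 2 * (q ^ 3) ^ j)))) := by
    rw [baileyKernel, show 2 * m + (j + 1) - 1 = r + 1 by omega,
      show 2 * m + (j + 1) = r + 1 + 1 by omega, qPoch_succ _ _ j, qPoch_succ _ _ j,
      qPoch_succ _ _ r, qPoch_succ _ _ (r + 1), hr2, hr']
  have k2 : baileyKernel q m j = q ^ m * (qPoch q (q ^ 3) j * qPoch (q ^ 3) (q ^ 3) r)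
      / (qPoch (q ^ 3) (q ^ 3) j * qPoch (q ^ 2) (q ^ 3) (r + 1)) := by
    rw [baileyKernel, show 2 * m + j - 1 = r by omega, show 2 * m + j = r + 1 by omega]
  have k3 : 2 * (m + 1) + j - 2 = r + 1 := by omega
  have k4 : 2 * (m + 1) + j - 1 = r + 1 + 1 := by omega
  have k5 : 2 * m + (j + 1) - 2 = r := by omega
  have k6 : 2 * m + (j + 1) - 1 = r + 1 := by omega
  have n1 := qPoch_ne_zero (one_sub_pow_mul_ne_zero hq1 three_ne_zero) j
  have n2 := qPoch_ne_zero (one_sub_pow_mul_ne_zero hq1 two_ne_zero) (r + 1)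
  have n3 := one_sub_pow_mul_ne_zero hq1 three_ne_zero j
  have n4 := one_sub_pow_mul_ne_zero hq1 two_ne_zero (r + 1)
  rw [hr'] at n4
  rw [k1, k2, poisedFactor, baileyCertificate, baileyCertificate, k3, k4, k5, k6,
    pow_succ (q ^ 3) (m + j), pow_add (q ^ 3) m j, pow_succ (q ^ 3) m, hdiv, pow_succ (q ^ 3) j,
    qPoch_succ _ _ j, qPoch_succ _ _ j, qPoch_succ _ _ (r + 1), qPoch_succ (q ^ 3) _ r, hr2, hr']
  have hc' : ∀ X Y : ℂ, X * (1 - (q ^ 3) ^ m * q ^ 3) * Y * denCubic q e₀ e₁ f₂ ((q ^ 3) ^ m)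
      * poisedCore q e₀ e₁ f₂ (m + 1) = X * Y * (poisedCore q e₀ e₁ f₂ m * (1 - (q ^ 3) ^ m / q)
        * numCubic q e₀ e₁ f₂ ((q ^ 3) ^ m / q)) := fun X Y => by
    linear_combination X * Y * hc
  rw [hc', pow_succ q m]
  clear hc hc' hr hr' hr2 hdiv k1 k2 hU
  generalize poisedCore q e₀ e₁ f₂ m = A, qPoch q (q ^ 3) j = B, qPoch (q ^ 3) (q ^ 3) r = C,
    qPoch (q ^ 3) (q ^ 3) j = D, qPoch (q ^ 2) (q ^ 3) (r + 1) = E, (q ^ 3) ^ m = M,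
    (q ^ 3) ^ j = J, q ^ m = z at *
  obtain ⟨F, hF⟩ : ∃ F, F = 1 - q ^ 3 * J := ⟨_, rfl⟩
  obtain ⟨K, hK⟩ : ∃ K, K = 1 - q ^ 2 * (M ^ 2 * J) := ⟨_, rfl⟩
  rw [← hF] at n3 ⊢
  rw [← hK] at n4 ⊢
  simp only [denCubic, numCubic]
  field_simp
  rw [hF, hK]
  ring

/-- The last term of the longer diagonal has no partner on the shorter one; it cancels the upper end
of the telescoping sum. -/
theorem bailey_boundary (hq0 : q ≠ 0) (hq1 : ‖q‖ < 1) (e₀ e₁ f₂ : ℂ) (n : ℕ) :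
    (1 - (q ^ 3) ^ (n + 1)) * denCubic q e₀ e₁ f₂ ((q ^ 3) ^ n)
        * (poisedFactor q e₀ e₁ f₂ (n + 1) * baileyKernel q (n + 1) 0)
      = -baileyCertificate q e₀ e₁ f₂ (n + 1) 0 := by
  have e1 : 2 * (n + 1) + 0 - 1 = 2 * n + 1 := by omega
  have e2 : 2 * (n + 1) + 0 - 2 = 2 * n := by omega
  have e3 : 2 * (n + 1) + 0 = 2 * n + 1 + 1 := by omega
  have e4 : (q ^ 3) ^ (n + 1) / q ^ 3 = (q ^ 3) ^ n := by rw [pow_succ]; field_simp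
  have e5 : (q ^ 3) ^ (2 * n) = ((q ^ 3) ^ n) ^ 2 := by rw [pow_mul']
  have n1 := qPoch_ne_zero (one_sub_pow_mul_ne_zero hq1 two_ne_zero) (2 * n + 1)
  have n2 := one_sub_pow_mul_ne_zero hq1 two_ne_zero (2 * n + 1)
  rw [pow_succ (q ^ 3), e5] at n2
  rw [poisedFactor, baileyKernel, baileyCertificate, e1, e2, e3, e4, qPoch_succ (q ^ 2),
    qPoch_succ (q ^ 3) (q ^ 3) (2 * n), pow_succ (q ^ 3) (2 * n), pow_succ (q ^ 3) n, e5]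
  simp only [qPoch_zero, pow_zero]
  generalize poisedCore q e₀ e₁ f₂ (n + 1) = A, qPoch (q ^ 3) (q ^ 3) (2 * n) = C,
    qPoch (q ^ 2) (q ^ 3) (2 * n + 1) = E, (q ^ 3) ^ n = M, q ^ (n + 1) = z at *
  generalize denCubic q e₀ e₁ f₂ M = D
  obtain ⟨K, hK⟩ : ∃ K, K = 1 - q ^ 2 * (M ^ 2 * q ^ 3) := ⟨_, rfl⟩
  rw [← hK] at n2 ⊢
  field_simp
  rw [hK]
  ring

/-- A terminating very-well-poised summation. -/
theorem sum_poisedFactor_mul_baileyKernel (hq0 : q ≠ 0) (hq1 : ‖q‖ < 1) {e₀ e₁ f₂ : ℂ}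
    (hU : ∀ i : ℕ, denCubic q e₀ e₁ f₂ ((q ^ 3) ^ i) ≠ 0) (n : ℕ) :
    ∑ m ∈ range (n + 2), poisedFactor q e₀ e₁ f₂ m * baileyKernel q m (n + 1 - m)
      = (∏ i ∈ range (n + 1),
          numCubic q e₀ e₁ f₂ ((q ^ 3) ^ i) / denCubic q e₀ e₁ f₂ ((q ^ 3) ^ i))
        / (1 - (q ^ 3) ^ (n + 1)) := by
  induction n with
  | zero =>
    -- The induction starts on the diagonal m + j = 1, since the closed form would divide by zero on
    -- the diagonal 0.
    have h0 := hU 0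
    have h1 := one_sub_inv_ne_zero hq0 hq1
    have h2 : 1 - q ^ 2 ≠ 0 := one_sub_pow_ne_zero hq1 (by norm_num)
    have h3 : 1 - q ^ 3 ≠ 0 := one_sub_pow_ne_zero hq1 (by norm_num)
    have h4 : 1 - q ^ 5 ≠ 0 := one_sub_pow_ne_zero hq1 (by norm_num)
    have h5 : 1 - q ^ 2 * q ^ 3 ≠ 0 := by rwa [← pow_add]
    have h6 : q - 1 ≠ 0 := fun h => h1 (by rw [sub_eq_zero.1 h]; norm_num)
    simp only [sum_range_succ, range_zero, sum_empty, prod_range_succ, prod_empty, poisedFactor,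
      poisedCore, baileyKernel, qPoch, pow_zero, zero_add, one_mul, mul_one, pow_one, mul_zero,
      zero_add, Nat.sub_zero, Nat.sub_self, add_zero, Nat.reduceSub, one_pow] at h0 ⊢
    rw [denCubic] at h0 ⊢
    simp only [numCubic, one_pow, mul_one] at h0 ⊢
    field_simp
    ring
  | succ n ih =>
    have hn1 := one_sub_pow_ne_zero (norm_cube_lt_one hq1) n.succ_ne_zero
    have hn2 := one_sub_pow_ne_zero (norm_cube_lt_one hq1) (n + 1).succ_ne_zero
    have hd := hU (n + 1)
    have key : (1 - (q ^ 3) ^ (n + 1 + 1)) * denCubic q e₀ e₁ f₂ ((q ^ 3) ^ (n + 1))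
        * ∑ m ∈ range (n + 1 + 2), poisedFactor q e₀ e₁ f₂ m * baileyKernel q m (n + 1 + 1 - m)
        = (1 - (q ^ 3) ^ (n + 1)) * numCubic q e₀ e₁ f₂ ((q ^ 3) ^ (n + 1))
          * ∑ m ∈ range (n + 2), poisedFactor q e₀ e₁ f₂ m * baileyKernel q m (n + 1 - m) := by
      rw [sum_range_succ, mul_add, Nat.sub_self, bailey_boundary hq0 hq1, ← sub_eq_add_neg,
        sub_eq_iff_eq_add', ← sub_eq_iff_eq_add, mul_sum, mul_sum, ← sum_sub_distrib]
      have : ∀ m ∈ range (n + 2), (1 - (q ^ 3) ^ (n + 1 + 1))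
          * denCubic q e₀ e₁ f₂ ((q ^ 3) ^ (n + 1))
            * (poisedFactor q e₀ e₁ f₂ m * baileyKernel q m (n + 1 + 1 - m))
          - (1 - (q ^ 3) ^ (n + 1)) * numCubic q e₀ e₁ f₂ ((q ^ 3) ^ (n + 1))
            * (poisedFactor q e₀ e₁ f₂ m * baileyKernel q m (n + 1 - m))
          = baileyCertificate q e₀ e₁ f₂ (m + 1) (n + 2 - (m + 1))
            - baileyCertificate q e₀ e₁ f₂ m (n + 2 - m) := fun m hm => by
        obtain ⟨j, hj⟩ := Nat.exists_eq_add_of_le (Nat.lt_succ_iff.1 (mem_range.1 hm))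
        have h := bailey_telescope hq0 hq1 hU m j (by omega)
        rw [show n + 1 + 1 - m = j + 1 by omega, show n + 1 - m = j by omega,
          show n + 2 - (m + 1) = j by omega, hj]
        exact h
      rw [sum_congr rfl this,
        sum_range_sub (fun m => baileyCertificate q e₀ e₁ f₂ m (n + 2 - m))]
      -- The lower end vanishes through the factor 1 - (q³)^0 of the certificate.
      simp [baileyCertificate]
    rw [ih] at key
    rw [prod_range_succ]
    generalize ∑ m ∈ range (n + 1 + 2), poisedFactor q e₀ e₁ f₂ m
      * baileyKernel q m (n + 1 + 1 - m) = S at *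
    generalize ∏ i ∈ range (n + 1),
          numCubic q e₀ e₁ f₂ ((q ^ 3) ^ i) / denCubic q e₀ e₁ f₂ ((q ^ 3) ^ i) = R at *
    rw [eq_div_iff hn2]
    field_simp at key ⊢
    linear_combination key

end Terminating

/-! ### Summing the double series by diagonals and by rows. -/

section Exchange

variable {q : ℂ}

theorem exists_norm_baileyKernel_le (hq1 : ‖q‖ < 1) :
    ∃ C : ℝ, 0 < C ∧ ∀ m j, ‖baileyKernel q m j‖ ≤ C * ‖q‖ ^ m := by
  have hp := norm_cube_lt_one hq1
  obtain ⟨A, hA, hA'⟩ := exists_norm_qPoch_le q hp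
  obtain ⟨B, hB, hB'⟩ := exists_norm_qPoch_le (q ^ 3) hp
  obtain ⟨D, hD, hD'⟩ :=
    exists_norm_inv_qPoch_le hp (one_sub_pow_mul_ne_zero hq1 three_ne_zero)
  obtain ⟨E, hE, hE'⟩ := exists_norm_inv_qPoch_le hp (one_sub_pow_mul_ne_zero hq1 two_ne_zero)
  refine ⟨A * B * D * E, by positivity, fun m j => ?_⟩
  have h : baileyKernel q m j = qPoch q (q ^ 3) j * qPoch (q ^ 3) (q ^ 3) (2 * m + j - 1)
      * (qPoch (q ^ 3) (q ^ 3) j)⁻¹ * (qPoch (q ^ 2) (q ^ 3) (2 * m + j))⁻¹ * q ^ m := by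
    rw [baileyKernel, div_eq_mul_inv, mul_inv]; ring
  rw [h]
  simp only [norm_mul, norm_pow]
  gcongr
  exacts [hA' _, hB' _, hD' _, hE' _]

/-- With M = m + 1, splitting the shifted factorials at 2M turns the row into a q-Gauss series in
base q³ with a = q^{6M} and b = z = q; its infinite products cancel down to (q²; q³)_{2M}/(q;
q³)_{2M}. -/
theorem tsum_baileyKernel_row (hq0 : q ≠ 0) (hq1 : ‖q‖ < 1) (m : ℕ) :
    ∑' j, q ^ (m + 1 + j) * baileyKernel q (m + 1) j
      = q ^ (2 * (m + 1)) * qPoch (q ^ 3) (q ^ 3) (2 * (m + 1) - 1)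
        / qPoch q (q ^ 3) (2 * (m + 1)) := by
  have hp := norm_cube_lt_one hq1
  have hc : ∀ i : ℕ, 1 - q * (q ^ 3) ^ (2 * (m + 1)) * q * (q ^ 3) ^ i ≠ 0 := fun i => by
    have := one_sub_pow_mul_ne_zero hq1 two_ne_zero (2 * (m + 1) + i)
    rw [pow_add] at this
    convert this using 2
    ring
  have g := tsum_gaussTerm ((q ^ 3) ^ (2 * (m + 1))) q q hp hc hq1
  have e1 : q * (q ^ 3) ^ (2 * (m + 1)) * q = q ^ 2 * (q ^ 3) ^ (2 * (m + 1)) := by ring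
  rw [e1] at g hc
  have hq := one_sub_mul_cube_pow_ne_zero hq1
  have n1 := qPoch_ne_zero (one_sub_pow_mul_ne_zero hq1 two_ne_zero) (2 * (m + 1))
  have n2 := qPoch_ne_zero hq (2 * (m + 1))
  have n3 := qPochInf_ne_zero hp hc
  have n4 : qPochInf (q * (q ^ 3) ^ (2 * (m + 1))) (q ^ 3) ≠ 0 := qPochInf_ne_zero hp fun i => by
    have := hq (2 * (m + 1) + i); rwa [pow_add, ← mul_assoc] at this
  rw [← sq q, qPochInf_eq_mul (q ^ 2) hp (2 * (m + 1)), qPochInf_eq_mul q hp (2 * (m + 1))] at g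
  have t : ∀ j, q ^ (m + 1 + j) * baileyKernel q (m + 1) j
      = q ^ (2 * (m + 1)) * qPoch (q ^ 3) (q ^ 3) (2 * (m + 1) - 1)
        / qPoch (q ^ 2) (q ^ 3) (2 * (m + 1))
        * gaussTerm ((q ^ 3) ^ (2 * (m + 1))) q (q ^ 2 * (q ^ 3) ^ (2 * (m + 1))) q (q ^ 3) j := by
    intro j
    have e2 : 2 * (m + 1) + j - 1 = (2 * (m + 1) - 1) + j := by omega
    have e3 : q ^ 3 * (q ^ 3) ^ (2 * (m + 1) - 1) = (q ^ 3) ^ (2 * (m + 1)) := by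
      rw [← pow_succ', Nat.sub_add_cancel (by omega)]
    rw [baileyKernel, gaussTerm, e2, qPoch_add, e3, qPoch_add (q ^ 2), pow_add q (m + 1) j,
      two_mul (m + 1), pow_add q (m + 1) (m + 1)]
    simp only [div_eq_mul_inv, mul_inv]
    ring
  simp only [t]
  rw [tsum_mul_left, g]
  field_simp

theorem poisedFactor_zero (hq0 : q ≠ 0) (hq1 : ‖q‖ < 1) (e₀ e₁ f₂ : ℂ) :
    poisedFactor q e₀ e₁ f₂ 0 = 1 := by
  have := one_sub_inv_ne_zero hq0 hq1
  simp only [poisedFactor, poisedCore, qPoch_zero, range_zero, prod_empty, pow_zero, one_pow,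
    mul_one]
  rw [mul_one_div, div_self this]

/-- Boundedness of the factor V and of the kernel makes the double series absolutely convergent,
dominated by a multiple of |q|^{m+j}, so diagonals and rows have the same total. -/
theorem poised_transformation (hq0 : q ≠ 0) (hq1 : ‖q‖ < 1) {e₀ e₁ f₂ : ℂ}
    (hU : ∀ i : ℕ, denCubic q e₀ e₁ f₂ ((q ^ 3) ^ i) ≠ 0)
    (hV : ∃ C : ℝ, 0 < C ∧ ∀ m, ‖poisedFactor q e₀ e₁ f₂ m‖ ≤ C) :
    Summable (fun n : ℕ => (∏ i ∈ range (n + 1),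
      numCubic q e₀ e₁ f₂ ((q ^ 3) ^ i) / denCubic q e₀ e₁ f₂ ((q ^ 3) ^ i))
        * q ^ (n + 1) / (1 - (q ^ 3) ^ (n + 1))) ∧
    Summable (fun m : ℕ => poisedFactor q e₀ e₁ f₂ (m + 1) * (q ^ (2 * (m + 1))
      * qPoch (q ^ 3) (q ^ 3) (2 * (m + 1) - 1) / qPoch q (q ^ 3) (2 * (m + 1)))) ∧
    ∑' n : ℕ, (∏ i ∈ range (n + 1),
      numCubic q e₀ e₁ f₂ ((q ^ 3) ^ i) / denCubic q e₀ e₁ f₂ ((q ^ 3) ^ i))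
        * q ^ (n + 1) / (1 - (q ^ 3) ^ (n + 1))
      = ∑' j, gaussLogTerm q (q ^ 2) q (q ^ 3) j
        + ∑' m : ℕ, poisedFactor q e₀ e₁ f₂ (m + 1) * (q ^ (2 * (m + 1))
          * qPoch (q ^ 3) (q ^ 3) (2 * (m + 1) - 1) / qPoch q (q ^ 3) (2 * (m + 1))) := by
  obtain ⟨A, hA, hA'⟩ := hV
  obtain ⟨B, hB, hB'⟩ := exists_norm_baileyKernel_le hq1
  set h : ℕ × ℕ → ℂ := fun x =>
    q ^ (x.1 + x.2) * (poisedFactor q e₀ e₁ f₂ x.1 * baileyKernel q x.1 x.2) with hh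
  have geo := summable_geometric_of_lt_one (norm_nonneg q) hq1
  have hs : Summable h := by
    refine .of_norm_bounded ((geo.mul_of_nonneg geo (fun _ => by positivity)
      (fun _ => by positivity)).mul_left (A * B)) fun x => ?_
    simp only [hh, norm_mul, norm_pow]
    calc ‖q‖ ^ (x.1 + x.2) * (‖poisedFactor q e₀ e₁ f₂ x.1‖ * ‖baileyKernel q x.1 x.2‖)
        ≤ ‖q‖ ^ (x.1 + x.2) * (A * (B * 1)) := by
          gcongr
          · exact hA' _
          · refine (hB' _ _).trans ?_
            gcongr
            exact pow_le_one₀ (norm_nonneg _) hq1.le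
      _ = A * B * (‖q‖ ^ x.1 * ‖q‖ ^ x.2) := by rw [pow_add]; ring
  have hdiag : ∀ n : ℕ, ∑ x ∈ antidiagonal (n + 1), h x = (∏ i ∈ range (n + 1),
      numCubic q e₀ e₁ f₂ ((q ^ 3) ^ i) / denCubic q e₀ e₁ f₂ ((q ^ 3) ^ i))
        * q ^ (n + 1) / (1 - (q ^ 3) ^ (n + 1)) := fun n => by
    rw [Nat.sum_antidiagonal_eq_sum_range_succ_mk, mul_div_right_comm,
      ← sum_poisedFactor_mul_baileyKernel hq0 hq1 hU, sum_mul]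
    refine sum_congr rfl fun m hm => ?_
    simp only [hh, Nat.add_sub_cancel' (Nat.lt_succ_iff.1 (mem_range.1 hm))]
    ring
  have hrow : ∀ m : ℕ, ∑' j, h (m + 1, j) = poisedFactor q e₀ e₁ f₂ (m + 1) * (q ^ (2 * (m + 1))
      * qPoch (q ^ 3) (q ^ 3) (2 * (m + 1) - 1) / qPoch q (q ^ 3) (2 * (m + 1))) := fun m => by
    rw [← tsum_baileyKernel_row hq0 hq1, ← tsum_mul_left]
    refine tsum_congr fun j => ?_
    simp only [hh]
    ring
  -- Truncated subtraction reads the index 0 - 1 as 0. The corner is both diagonal 0 and the start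
  -- of row 0, so it cancels in the comparison.
  have h00 : h (0, 0) = 1 := by
    simp [hh, poisedFactor_zero hq0 hq1, baileyKernel, qPoch_zero]
  have h0 : ∀ j, h (0, j + 1) = gaussLogTerm q (q ^ 2) q (q ^ 3) j := fun j => by
    have n1 := qPoch_ne_zero (one_sub_pow_mul_ne_zero hq1 three_ne_zero) j
    simp only [hh, poisedFactor_zero hq0 hq1, baileyKernel, gaussLogTerm, mul_zero, zero_add,
      Nat.add_sub_cancel, pow_zero, one_mul, qPoch_succ (q ^ 3)]
    rw [← pow_succ' (q ^ 3)]
    field_simp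
  have sd : Summable fun n => ∑ x ∈ antidiagonal n, h x := by
    have := ((HasAntidiagonal.sigmaAntidiagonalEquivProd : _ ≃ ℕ × ℕ).summable_iff.2 hs).sigma
    simpa [Function.comp_def, tsum_fintype, sum_coe_sort, sum_attach] using this
  have td : ∑' x, h x = ∑' n, ∑ x ∈ antidiagonal n, h x := by
    rw [← (HasAntidiagonal.sigmaAntidiagonalEquivProd : _ ≃ ℕ × ℕ).tsum_eq]
    refine Eq.trans ((HasAntidiagonal.sigmaAntidiagonalEquivProd
      : _ ≃ ℕ × ℕ).summable_iff.2 hs).tsum_sigma ?_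
    refine tsum_congr fun n => ?_
    rw [tsum_fintype]
    exact sum_coe_sort (antidiagonal n) h
  have sr := hs.prod
  have s0 := hs.prod_factor 0
  have key : ∑' n, ∑ x ∈ antidiagonal n, h x = ∑' m, ∑' j, h (m, j) := by
    rw [← td, hs.tsum_prod]
  rw [sd.tsum_eq_zero_add, sr.tsum_eq_zero_add, s0.tsum_eq_zero_add] at key
  simp only [hdiag, hrow, h0, Nat.antidiagonal_zero, sum_singleton, h00] at key
  refine ⟨?_, ?_, ?_⟩
  · simpa only [hdiag] using (summable_nat_add_iff 1).2 sd
  · simpa only [hrow] using (summable_nat_add_iff 1).2 sr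
  · linear_combination key

end Exchange

/-! ### Jacobi's triple product from the finite q-binomial theorem. -/

section TripleProduct

/-- The integer `n (n - 1) / 2`. -/
def tri (n : ℤ) : ℤ := n * (n - 1) / 2

theorem two_mul_tri (n : ℤ) : 2 * tri n = n * (n - 1) :=
  Int.mul_ediv_cancel' (Int.even_mul_pred_self n).two_dvd

theorem choose_two_eq_tri (k : ℕ) : ((k.choose 2 : ℕ) : ℤ) = tri k := by
  have h : 2 * ((k.choose 2 : ℕ) : ℤ) = k * (k - 1) := by
    induction k with
    | zero => simp
    | succ k ih =>
      rw [Nat.choose_succ_succ' k 1, Nat.choose_one_right]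
      push_cast
      linarith
  have := two_mul_tri k
  linarith

/-- The term `(-1)ⁿ q ^ (n (n - 1) / 2) zⁿ` of Jacobi's theta series. -/
noncomputable def thetaTerm (q z : ℂ) (n : ℤ) : ℂ := (-1) ^ n * q ^ tri n * z ^ n

/-- Jacobi's theta series. -/
noncomputable def thetaSum (q z : ℂ) : ℂ := ∑' n : ℤ, thetaTerm q z n

theorem thetaTerm_natCast (q z : ℂ) (n : ℕ) :
    thetaTerm q z n = (-1) ^ n * q ^ n.choose 2 * z ^ n := by
  rw [thetaTerm, ← choose_two_eq_tri]
  simp only [zpow_natCast]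

variable {q z : ℂ}

theorem thetaTerm_div_neg (hq0 : q ≠ 0) (hz0 : z ≠ 0) (n : ℤ) :
    thetaTerm q (q / z) (-n) = thetaTerm q z n := by
  have h : tri (-n) + (-n) = tri n := by
    have h1 := two_mul_tri n
    have h2 := two_mul_tri (-n)
    linarith
  rw [thetaTerm, thetaTerm, div_zpow, ← h, zpow_add₀ hq0, zpow_neg (-1 : ℂ), zpow_neg z]
  have h1 : ((-1 : ℂ) ^ n)⁻¹ = (-1) ^ n := by rw [← inv_zpow]; norm_num
  rw [h1]
  field_simp

theorem summable_choose_two_pow (hq0 : q ≠ 0) (hq1 : ‖q‖ < 1) (hz0 : z ≠ 0) :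
    Summable fun n : ℕ => ‖q ^ n.choose 2 * z ^ n‖ := by
  refine summable_of_ratio_test_tendsto_lt_one zero_lt_one
    (.of_forall fun n => norm_ne_zero_iff.2
      (mul_ne_zero (pow_ne_zero _ hq0) (pow_ne_zero _ hz0))) (l := 0) ?_
  have : ∀ n : ℕ, ‖‖q ^ (n + 1).choose 2 * z ^ (n + 1)‖‖ / ‖‖q ^ n.choose 2 * z ^ n‖‖
      = ‖q‖ ^ n * ‖z‖ := fun n => by
    have h1 : ‖q‖ ≠ 0 := norm_ne_zero_iff.2 hq0
    have h2 : ‖z‖ ≠ 0 := norm_ne_zero_iff.2 hz0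
    simp only [norm_norm, norm_mul, norm_pow]
    rw [Nat.choose_succ_succ' n 1, Nat.choose_one_right, pow_add, pow_succ]
    field_simp
  simp only [this]
  simpa using (tendsto_pow_atTop_nhds_zero_of_lt_one (norm_nonneg q) hq1).mul_const ‖z‖

theorem summable_norm_thetaTerm (hq0 : q ≠ 0) (hq1 : ‖q‖ < 1) (hz0 : z ≠ 0) :
    Summable fun n : ℤ => ‖thetaTerm q z n‖ := by
  have h : ∀ {w : ℂ}, w ≠ 0 → Summable fun n : ℕ => ‖thetaTerm q w n‖ := fun hw => by
    simpa [thetaTerm_natCast] using summable_choose_two_pow hq0 hq1 hw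
  refine .of_nat_of_neg (h hz0) ?_
  have := h (div_ne_zero hq0 hz0)
  refine this.congr fun n => ?_
  rw [← thetaTerm_div_neg hq0 hz0 (-n), neg_neg]

theorem thetaSum_div (hq0 : q ≠ 0) (hz0 : z ≠ 0) : thetaSum q (q / z) = thetaSum q z := by
  rw [thetaSum, thetaSum, ← (Equiv.neg ℤ).tsum_eq]
  exact tsum_congr fun n => thetaTerm_div_neg hq0 hz0 n

/-- The Gaussian binomial coefficient. -/
noncomputable def gaussBinom (q : ℂ) (M k : ℕ) : ℂ :=
  if k ≤ M then qPoch q q M / (qPoch q q k * qPoch q q (M - k)) else 0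

theorem qPoch_self_ne_zero (hq1 : ‖q‖ < 1) (n : ℕ) : qPoch q q n ≠ 0 :=
  qPoch_ne_zero (one_sub_mul_pow_ne_zero hq1 hq1.le) n

theorem gaussBinom_zero (hq1 : ‖q‖ < 1) (M : ℕ) : gaussBinom q M 0 = 1 := by
  simp [gaussBinom, qPoch_zero, div_self (qPoch_self_ne_zero hq1 M)]

/-- q-Pascal with M = k + l. For l = 0 it relies on the default value 0 of the coefficient when k +
1 > M. -/
theorem gaussBinom_succ_succ (hq1 : ‖q‖ < 1) (k l : ℕ) :
    gaussBinom q (k + l + 1) (k + 1)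
      = gaussBinom q (k + l) (k + 1) + q ^ l * gaussBinom q (k + l) k := by
  have n1 := qPoch_self_ne_zero hq1 k
  have n2 := qPoch_self_ne_zero hq1 l
  have n3 := one_sub_mul_pow_ne_zero hq1 hq1.le k
  have n4 := one_sub_mul_pow_ne_zero hq1 hq1.le l
  rw [gaussBinom, gaussBinom, gaussBinom, if_pos (by omega), if_pos (by omega : k ≤ k + l),
    show k + l + 1 - (k + 1) = l by omega, Nat.add_sub_cancel_left]
  rcases l with _ | l
  · have n5 := one_sub_mul_pow_ne_zero hq1 hq1.le (k + 0)
    rw [if_neg (by omega), qPoch_succ, qPoch_zero]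
    simp only [add_zero, pow_zero] at n5 ⊢
    field_simp
    ring
  · have n5 := qPoch_self_ne_zero hq1 l
    have n6 := one_sub_mul_pow_ne_zero hq1 hq1.le l
    rw [if_pos (by omega), show k + (l + 1) - (k + 1) = l by omega, qPoch_succ _ _ (k + (l + 1)),
      qPoch_succ _ _ k, qPoch_succ _ _ l, pow_add q k, pow_succ q l]
    generalize qPoch q q (k + (l + 1)) = A, qPoch q q k = B, qPoch q q l = C, q ^ k = x,
      q ^ l = y at *
    have n7 : 1 - x * q ≠ 0 := by rwa [mul_comm]
    have n8 : 1 - y * q ≠ 0 := by rwa [mul_comm]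
    field_simp
    ring

/-- The finite `q`-binomial theorem. -/
theorem qPoch_eq_sum (hq1 : ‖q‖ < 1) (x : ℂ) (M : ℕ) :
    qPoch x q M = ∑ k ∈ range (M + 1), (-1) ^ k * q ^ k.choose 2 * x ^ k * gaussBinom q M k := by
  induction M with
  | zero => simp [gaussBinom, qPoch_zero]
  | succ M ih =>
    have h : ∀ k ∈ range (M + 1), (-1) ^ (k + 1) * q ^ (k + 1).choose 2 * x ^ (k + 1)
        * gaussBinom q (M + 1) (k + 1)
        = (-1) ^ (k + 1) * q ^ (k + 1).choose 2 * x ^ (k + 1) * gaussBinom q M (k + 1)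
          - x * q ^ M * ((-1) ^ k * q ^ k.choose 2 * x ^ k * gaussBinom q M k) := fun k hk => by
      obtain ⟨l, rfl⟩ := Nat.exists_eq_add_of_le (Nat.lt_succ_iff.1 (mem_range.1 hk))
      rw [gaussBinom_succ_succ hq1, Nat.choose_succ_succ' k 1, Nat.choose_one_right, pow_add q k,
        pow_add q k]
      ring
    have h0 : ∑ k ∈ range (M + 1), (-1) ^ (k + 1) * q ^ (k + 1).choose 2 * x ^ (k + 1)
        * gaussBinom q M (k + 1) + 1 = qPoch x q M := by
      have h1 := sum_range_succ' (fun k => (-1) ^ k * q ^ k.choose 2 * x ^ k * gaussBinom q M k)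
        (M + 1)
      rw [sum_range_succ, ← ih] at h1
      simpa [gaussBinom, qPoch_zero, div_self (qPoch_self_ne_zero hq1 M)] using h1.symm
    rw [sum_range_succ', sum_congr rfl h, sum_sub_distrib, ← mul_sum, ← ih, qPoch_succ, ← h0]
    simp [gaussBinom_zero hq1]
    ring

/-- Each factor 1 - z q^{-i} equals -z q^{-i}(1 - q^i/z); collecting the powers of q gives the
triangular exponent. -/
theorem qPoch_mul_inv_pow (hq0 : q ≠ 0) (hz0 : z ≠ 0) (N : ℕ) :
    qPoch (z * (q ^ N)⁻¹) q N * q ^ (N + 1).choose 2 = (-1) ^ N * z ^ N * qPoch (q / z) q N := by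
  induction N with
  | zero => simp [qPoch_zero]
  | succ N ih =>
    have h1 : qPoch (z * (q ^ (N + 1))⁻¹) q (N + 1)
        = (1 - z * (q ^ (N + 1))⁻¹) * qPoch (z * (q ^ N)⁻¹) q N := by
      rw [add_comm N 1, qPoch_add, pow_one]
      congr 1
      · simp [qPoch]
      · congr 1
        rw [pow_add]; field_simp
    rw [h1, Nat.choose_succ_succ' (N + 1) 1, Nat.choose_one_right, qPoch_succ, pow_add]
    have h2 : (1 - z * (q ^ (N + 1))⁻¹) * q ^ (N + 1) = -z * (1 - q / z * q ^ N) := by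
      rw [pow_succ]; field_simp; ring
    linear_combination (1 - z * (q ^ (N + 1))⁻¹) * q ^ (N + 1) * ih
      + (-1) ^ N * z ^ N * qPoch (q / z) q N * h2

/-- A finite triple product: the q-binomial theorem for (z q^{-N}; q)_{2N}, recentred by n = k - N.
Extending the sum by zero to ℤ prepares the limit N → ∞. -/
theorem qPoch_mul_qPoch_div (hq0 : q ≠ 0) (hq1 : ‖q‖ < 1) (hz0 : z ≠ 0) (N : ℕ) :
    qPoch z q N * qPoch (q / z) q N
      = ∑' n : ℤ, if n ∈ Icc (-N : ℤ) N then
          thetaTerm q z n * gaussBinom q (2 * N) (n + N).toNat else 0 := by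
  rw [tsum_eq_sum (s := Icc (-N : ℤ) N) (fun n hn => if_neg hn),
    sum_congr rfl fun n hn => if_pos hn]
  have h := qPoch_eq_sum hq1 (z * (q ^ N)⁻¹) (2 * N)
  have h1 := qPoch_mul_inv_pow hq0 hz0 N
  rw [two_mul, qPoch_add, inv_mul_cancel_right₀ (pow_ne_zero N hq0), ← two_mul] at h
  have hsum : ∑ k ∈ range (2 * N + 1), (-1) ^ k * q ^ k.choose 2 * (z * (q ^ N)⁻¹) ^ k
      * gaussBinom q (2 * N) k = (-1) ^ N * z ^ N * (q ^ (N + 1).choose 2)⁻¹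
        * ∑ n ∈ Icc (-N : ℤ) N, thetaTerm q z n * gaussBinom q (2 * N) (n + N).toNat := by
    rw [mul_sum]
    refine sum_nbij' (fun k => (k : ℤ) - N) (fun n => (n + N).toNat) ?_ ?_ ?_ ?_ ?_
    · intro k hk; rw [mem_range] at hk; rw [mem_Icc]; omega
    · intro n hn; rw [mem_Icc] at hn; rw [mem_range]; omega
    · intro k hk; simp
    · intro n hn; rw [mem_Icc] at hn; omega
    · intro k hk
      have e : ((k : ℤ) - N + N).toNat = k := by simp
      have t : (k.choose 2 : ℤ) - N * k = -((N + 1).choose 2 : ℕ) + tri (k - N) := by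
        have h1 := two_mul_tri (k - N)
        have h2 := two_mul_tri k
        have h3 := two_mul_tri ((N + 1 : ℕ) : ℤ)
        rw [choose_two_eq_tri, choose_two_eq_tri]
        push_cast at *
        linarith
      have hq : q ^ k.choose 2 * ((q ^ N)⁻¹) ^ k
          = (q ^ (N + 1).choose 2)⁻¹ * q ^ tri (k - N) := by
        have := congrArg (fun n : ℤ => q ^ n) t
        rw [zpow_sub₀ hq0, zpow_add₀ hq0, zpow_neg, zpow_natCast, zpow_natCast, zpow_mul,
          zpow_natCast, zpow_natCast] at this
        rw [inv_pow, ← this]; rfl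
      have hm : (-1 : ℂ) ^ k = (-1) ^ N * (-1) ^ ((k : ℤ) - N) := by
        rw [← zpow_natCast, ← zpow_natCast, ← zpow_add₀ (by norm_num)]; congr 1; ring
      have hz : z ^ k = z ^ N * z ^ ((k : ℤ) - N) := by
        rw [← zpow_natCast, ← zpow_natCast, ← zpow_add₀ hz0]; congr 1; ring
      rw [e, thetaTerm, mul_pow, hm, hz]
      linear_combination (-1) ^ N * (-1) ^ ((k : ℤ) - N) * (z ^ N * z ^ ((k : ℤ) - N))
        * gaussBinom q (2 * N) k * hq
  rw [hsum] at h
  have n1 : q ^ (N + 1).choose 2 ≠ 0 := pow_ne_zero _ hq0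
  have n2 : (-1 : ℂ) ^ N * z ^ N ≠ 0 := mul_ne_zero (by simp) (pow_ne_zero _ hz0)
  refine mul_left_cancel₀ n2 ?_
  have h2 : (-1) ^ N * z ^ N * (qPoch z q N * qPoch (q / z) q N)
      = qPoch (z * (q ^ N)⁻¹) q N * qPoch z q N * q ^ (N + 1).choose 2 := by
    linear_combination -qPoch z q N * h1
  rw [h2, h]
  field_simp

/-- **Jacobi's triple product identity**. -/
theorem thetaSum_eq (hq0 : q ≠ 0) (hq1 : ‖q‖ < 1) (hz0 : z ≠ 0) :
    thetaSum q z = qPochInf q q * qPochInf z q * qPochInf (q / z) q := by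
  have n0 := qPochInf_ne_zero hq1 (one_sub_mul_pow_ne_zero hq1 hq1.le)
  obtain ⟨A, hA, hA'⟩ := exists_norm_qPoch_le q hq1
  obtain ⟨B, hB, hB'⟩ := exists_norm_inv_qPoch_le hq1 (one_sub_mul_pow_ne_zero hq1 hq1.le)
  have hg : ∀ M k, ‖gaussBinom q M k‖ ≤ A * B * B := fun M k => by
    rw [gaussBinom]
    split_ifs
    · rw [div_eq_mul_inv, mul_inv, norm_mul, norm_mul, ← mul_assoc]
      gcongr
      exacts [hA' _, hB' _, hB' _]
    · rw [norm_zero]; positivity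
  -- For fixed n the central q-binomial coefficient tends to 1/(q; q)_∞, and all these coefficients
  -- are uniformly bounded.
  have lim : Tendsto (fun N : ℕ => ∑' n : ℤ, if n ∈ Icc (-N : ℤ) N then
      thetaTerm q z n * gaussBinom q (2 * N) (n + N).toNat else 0) atTop
      (𝓝 (∑' n : ℤ, thetaTerm q z n * (qPochInf q q)⁻¹)) := by
    refine tendsto_tsum_of_dominated_convergence
      (bound := fun n => ‖thetaTerm q z n‖ * (A * B * B))
      ((summable_norm_thetaTerm hq0 hq1 hz0).mul_right _) (fun n => ?_)
      (.of_forall fun N n => ?_)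
    · have t1 : Tendsto (fun N : ℕ => 2 * N) atTop atTop :=
        tendsto_atTop_mono (fun N => by change N ≤ 2 * N; omega) tendsto_id
      have t2 : Tendsto (fun N : ℕ => (n + N).toNat) atTop atTop :=
        tendsto_atTop_mono' _ (eventually_atTop.2 ⟨0, fun N _ => by
          change N - n.natAbs ≤ (n + N).toNat; omega⟩) (tendsto_sub_atTop_nat n.natAbs)
      have t3 : Tendsto (fun N : ℕ => 2 * N - (n + N).toNat) atTop atTop :=
        tendsto_atTop_mono' _ (eventually_atTop.2 ⟨n.natAbs, fun N _ => by
          change N - n.natAbs ≤ 2 * N - (n + N).toNat; omega⟩) (tendsto_sub_atTop_nat n.natAbs)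
      have T := tendsto_qPoch q hq1
      have key := ((T.comp t1).div ((T.comp t2).mul (T.comp t3)) (mul_ne_zero n0 n0)).const_mul
        (thetaTerm q z n)
      have e : qPochInf q q / (qPochInf q q * qPochInf q q) = (qPochInf q q)⁻¹ := by field_simp
      rw [e] at key
      refine key.congr' (eventually_atTop.2 ⟨n.natAbs, fun N hN => ?_⟩)
      have hn : n ∈ Icc (-N : ℤ) N := by rw [mem_Icc]; omega
      have hk : (n + N).toNat ≤ 2 * N := by omega
      simp only [if_pos hn, gaussBinom, if_pos hk]
      rfl
    · split_ifs
      · rw [norm_mul]; gcongr; exact hg _ _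
      · rw [norm_zero]; positivity
  have := tendsto_nhds_unique (lim.congr fun N => (qPoch_mul_qPoch_div hq0 hq1 hz0 N).symm)
    ((tendsto_qPoch z hq1).mul (tendsto_qPoch (q / z) hq1))
  rw [tsum_mul_right] at this
  rw [thetaSum]
  field_simp at this
  linear_combination this

end TripleProduct

/-! ### The cube of the theta series, split by residues modulo 3. -/

section ThetaCube

variable {q z : ℂ}

theorem tri_add (k l : ℤ) : tri (k + l) = tri k + tri l + k * l := by
  have h1 := two_mul_tri (k + l)
  have h2 := two_mul_tri k
  have h3 := two_mul_tri l
  linarith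

theorem tri_one_sub (l : ℤ) : tri (1 - l) = tri l := by
  have h1 := two_mul_tri (1 - l)
  have h2 := two_mul_tri l
  linarith

/-- A term of the coefficient of `z ^ s` in the cube of the theta series. -/
noncomputable def thetaCubeTerm (q : ℂ) (s : ℤ) (x : ℤ × ℤ) : ℂ :=
  (-1) ^ s * q ^ (tri x.1 + tri x.2 + tri (s - x.1 - x.2))

/-- The coefficient of `z ^ s` in the cube of the theta series. -/
noncomputable def thetaCubeCoeff (q : ℂ) (s : ℤ) : ℂ := ∑' x, thetaCubeTerm q s x

theorem thetaCubeTerm_zero (q : ℂ) : thetaCubeTerm q 0 = cubicThetaTerm q := by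
  funext x
  have h : tri x.1 + tri x.2 + tri (0 - x.1 - x.2) = x.1 ^ 2 + x.1 * x.2 + x.2 ^ 2 := by
    have h1 := two_mul_tri x.1
    have h2 := two_mul_tri x.2
    have h3 := two_mul_tri (0 - x.1 - x.2)
    linarith
  rw [thetaCubeTerm, cubicThetaTerm, h, zpow_zero, one_mul]

theorem thetaCubeCoeff_zero (q : ℂ) : thetaCubeCoeff q 0 = cubicTheta q := by
  rw [thetaCubeCoeff, thetaCubeTerm_zero, cubicTheta]

/-- Shifting all three summation indices by k raises their sum by 3k, so only residues modulo 3
matter. -/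
theorem thetaCubeCoeff_three_mul_add (hq0 : q ≠ 0) (k j : ℤ) :
    thetaCubeCoeff q (3 * k + j) = (-1) ^ k * q ^ (3 * tri k + k * j) * thetaCubeCoeff q j := by
  rw [thetaCubeCoeff, thetaCubeCoeff, ← tsum_mul_left,
    ← ((Equiv.addLeft k).prodCongr (Equiv.addLeft k)).tsum_eq]
  refine tsum_congr fun x => ?_
  have h : tri (k + x.1) + tri (k + x.2) + tri (3 * k + j - (k + x.1) - (k + x.2))
      = 3 * tri k + k * j + (tri x.1 + tri x.2 + tri (j - x.1 - x.2)) := by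
    rw [show 3 * k + j - (k + x.1) - (k + x.2) = k + (j - x.1 - x.2) by ring, tri_add, tri_add,
      tri_add]
    ring
  have hs : (-1 : ℂ) ^ (3 * k + j) = (-1) ^ k * (-1) ^ j := by
    rw [zpow_add₀ (by norm_num), zpow_mul]; norm_num
  simp only [thetaCubeTerm, Equiv.prodCongr_apply, Prod.map_fst, Prod.map_snd,
    Equiv.coe_addLeft]
  rw [h, hs, zpow_add₀ hq0 (3 * tri k + k * j)]
  ring

/-- The reflection n ↦ 1 - n of all three indices preserves every n(n-1)/2 and sends the index sum 2
to 1; the sign (-1)^s changes. -/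
theorem thetaCubeCoeff_two (q : ℂ) : thetaCubeCoeff q 2 = -thetaCubeCoeff q 1 := by
  rw [thetaCubeCoeff, thetaCubeCoeff, ← tsum_neg,
    ← ((Equiv.subLeft (1 : ℤ)).prodCongr (Equiv.subLeft (1 : ℤ))).tsum_eq]
  refine tsum_congr fun x => ?_
  simp only [thetaCubeTerm, Equiv.prodCongr_apply, Prod.map_fst, Prod.map_snd,
    Equiv.subLeft_apply]
  rw [show (2 : ℤ) - (1 - x.1) - (1 - x.2) = 1 - (1 - x.1 - x.2) by ring, tri_one_sub, tri_one_sub,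
    tri_one_sub]
  norm_num

/-- The reindexing of `ℤ³` by the sum of the entries. -/
def tripleSumEquiv : ℤ × (ℤ × ℤ) ≃ (ℤ × ℤ) × ℤ where
  toFun x := (x.2, x.1 - x.2.1 - x.2.2)
  invFun y := (y.2 + y.1.1 + y.1.2, y.1)
  left_inv x := by ext <;> dsimp; ring
  right_inv y := by ext <;> dsimp; ring

theorem thetaTerm_mul_mul (hq0 : q ≠ 0) (hz0 : z ≠ 0) (x : ℤ × (ℤ × ℤ)) :
    thetaTerm q z x.2.1 * thetaTerm q z x.2.2 * thetaTerm q z (x.1 - x.2.1 - x.2.2)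
      = thetaCubeTerm q x.1 x.2 * z ^ x.1 := by
  have h : ∀ w : ℂ, w ≠ 0 → w ^ x.1 = w ^ x.2.1 * w ^ x.2.2 * w ^ (x.1 - x.2.1 - x.2.2) :=
    fun w hw => by rw [← zpow_add₀ hw, ← zpow_add₀ hw]; congr 1; ring
  rw [thetaCubeTerm, h z hz0, h (-1) (by norm_num), zpow_add₀ hq0, zpow_add₀ hq0]
  simp only [thetaTerm]
  ring

theorem summable_thetaCubeTerm_mul (hq0 : q ≠ 0) (hq1 : ‖q‖ < 1) (hz0 : z ≠ 0) :
    Summable fun x : ℤ × (ℤ × ℤ) => thetaCubeTerm q x.1 x.2 * z ^ x.1 := by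
  have h := summable_norm_thetaTerm hq0 hq1 hz0
  have h2 := (h.mul_norm h).mul_norm h
  refine (tripleSumEquiv.summable_iff.2 h2.of_norm).congr fun x => ?_
  exact thetaTerm_mul_mul hq0 hz0 x

theorem thetaSum_pow_three_eq_tsum (hq0 : q ≠ 0) (hq1 : ‖q‖ < 1) (hz0 : z ≠ 0) :
    thetaSum q z ^ 3 = ∑' s, thetaCubeCoeff q s * z ^ s := by
  have h := summable_norm_thetaTerm hq0 hq1 hz0
  have h1 : thetaSum q z ^ 3 = ∑' x : (ℤ × ℤ) × ℤ,
      thetaTerm q z x.1.1 * thetaTerm q z x.1.2 * thetaTerm q z x.2 := by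
    rw [pow_succ, sq, thetaSum, tsum_mul_tsum_of_summable_norm h h,
      tsum_mul_tsum_of_summable_norm (h.mul_norm h) h]
  rw [h1, ← tripleSumEquiv.tsum_eq]
  refine (tsum_congr (thetaTerm_mul_mul hq0 hz0)).trans ?_
  rw [(summable_thetaCubeTerm_mul hq0 hq1 hz0).tsum_prod]
  exact tsum_congr fun s => tsum_mul_right (a := z ^ s)

theorem summable_cubicThetaTerm (hq0 : q ≠ 0) (hq1 : ‖q‖ < 1) : Summable (cubicThetaTerm q) := by
  rw [← thetaCubeTerm_zero]
  simpa using (summable_thetaCubeTerm_mul hq0 hq1 one_ne_zero).prod_factor 0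

theorem tsum_int_eq_tsum_three {f : ℤ → ℂ} (hf : Summable f)
    (h : ∀ j : ℤ, Summable fun k : ℤ => f (3 * k + j)) :
    ∑' n, f n = ∑' k, f (3 * k) + ∑' k, f (3 * k + 1) + ∑' k, f (3 * k + 2) := by
  have h0 := h 0
  simp only [add_zero] at h0
  rw [← (Int.divModEquiv 3).symm.tsum_eq, ← h0.tsum_add (h 1), ← (h0.add (h 1)).tsum_add (h 2)]
  refine ((Int.divModEquiv 3).symm.summable_iff.2 hf).tsum_prod.trans ?_
  refine tsum_congr fun k => ?_
  rw [tsum_fintype, Fin.sum_univ_three]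
  simp [Int.divModEquiv, mul_comm]

theorem thetaSum_pow_three (hq0 : q ≠ 0) (hq1 : ‖q‖ < 1) (hz0 : z ≠ 0) :
    thetaSum q z ^ 3 = cubicTheta q * thetaSum (q ^ 3) (z ^ 3)
      + thetaCubeCoeff q 1 * (z * thetaSum (q ^ 3) (q * z ^ 3)
        - z ^ 2 * thetaSum (q ^ 3) (q ^ 2 * z ^ 3)) := by
  have hs : Summable fun s => thetaCubeCoeff q s * z ^ s :=
    (summable_thetaCubeTerm_mul hq0 hq1 hz0).prod.congr fun s => tsum_mul_right (a := z ^ s)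
  have e : ∀ j : ℕ, ∀ k : ℤ, thetaCubeCoeff q (3 * k + j) * z ^ (3 * k + j)
      = thetaCubeCoeff q j * z ^ j * thetaTerm (q ^ 3) (q ^ j * z ^ 3) k := fun j k => by
    rw [thetaCubeCoeff_three_mul_add hq0, zpow_add₀ hq0, zpow_add₀ hz0, thetaTerm, mul_zpow,
      zpow_mul q 3, zpow_mul z 3, mul_comm k, zpow_mul q j]
    simp only [zpow_natCast]
    norm_cast
    ring
  have hsub : ∀ j : ℤ, Summable fun k : ℤ => thetaCubeCoeff q (3 * k + j) * z ^ (3 * k + j) :=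
    fun j => hs.comp_injective (i := fun k : ℤ => 3 * k + j) fun a b h => by
      simp only at h; omega
  have e0 := e 0
  have e1 := e 1
  have e2 := e 2
  simp only [Nat.cast_zero, Nat.cast_one, Nat.cast_ofNat, add_zero, pow_zero, one_mul, pow_one,
    mul_one] at e0 e1 e2
  rw [thetaSum_pow_three_eq_tsum hq0 hq1 hz0, tsum_int_eq_tsum_three hs hsub, tsum_congr e0,
    tsum_congr e1, tsum_congr e2, tsum_mul_left, tsum_mul_left, tsum_mul_left,
    thetaCubeCoeff_zero, thetaCubeCoeff_two, thetaSum, thetaSum, thetaSum]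
  ring

end ThetaCube

/-! ### The Lambert series of a(q), by differentiation at z = 1. -/

section Lambert

variable {q : ℂ}

theorem summable_pow_div_one_sub {p x : ℂ} (hp : ‖p‖ < 1) (hx : ∀ i : ℕ, 1 - x * p ^ i ≠ 0) :
    Summable fun i : ℕ => p ^ i / (1 - x * p ^ i) := by
  obtain ⟨B, hB, hB'⟩ := exists_norm_inv_qPoch_le hp hx
  obtain ⟨A, hA, hA'⟩ := exists_norm_qPoch_le x hp
  refine .of_norm_bounded ((summable_geometric_of_lt_one (norm_nonneg p) hp).mul_left (A * B))
    fun i => ?_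
  have h1 : p ^ i / (1 - x * p ^ i) = qPoch x p i * (qPoch x p (i + 1))⁻¹ * p ^ i := by
    have := qPoch_ne_zero hx i
    have := hx i
    rw [qPoch_succ]
    field_simp
  rw [h1, norm_mul, norm_mul, norm_pow]
  gcongr
  exacts [hA' _, hB' _]

/-- The logarithmic derivative of the locally uniformly convergent product is taken factor by
factor. -/
theorem hasDerivAt_qPochInf {p x : ℂ} (hp : ‖p‖ < 1) (hx : ∀ i : ℕ, 1 - x * p ^ i ≠ 0) :
    HasDerivAt (fun y => qPochInf y p)
      (-qPochInf x p * ∑' i : ℕ, p ^ i / (1 - x * p ^ i)) x := by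
  have hu : Summable fun i : ℕ => (‖x‖ + 1) * ‖p‖ ^ i :=
    (summable_geometric_of_lt_one (norm_nonneg p) hp).mul_left _
  have hm : MultipliableLocallyUniformlyOn (fun (i : ℕ) (y : ℂ) => 1 - y * p ^ i)
      (Metric.ball x 1) := by
    have := hu.multipliableLocallyUniformlyOn_nat_one_add (f := fun i y => -(y * p ^ i))
      (K := Metric.ball x 1) Metric.isOpen_ball (.of_forall fun i y hy => by
        rw [norm_neg, norm_mul, norm_pow]
        gcongr
        have h1 : ‖y - x‖ < 1 := by simpa [dist_eq_norm] using hy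
        have h2 := norm_add_le (y - x) x
        rw [sub_add_cancel] at h2
        linarith) (fun i => by fun_prop)
    simpa [sub_eq_add_neg] using this
  have hxm : x ∈ Metric.ball x 1 := Metric.mem_ball_self one_pos
  have hd : ∀ i : ℕ, DifferentiableOn ℂ (fun y : ℂ => 1 - y * p ^ i) (Metric.ball x 1) :=
    fun i => by fun_prop
  have hdiff : DifferentiableAt ℂ (fun y => qPochInf y p) x :=
    (hm.hasProdLocallyUniformlyOn.differentiableOn (.of_forall fun s => by fun_prop)
      Metric.isOpen_ball).differentiableAt (Metric.isOpen_ball.mem_nhds hxm)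
  have hlog : ∀ i : ℕ, logDeriv (fun y : ℂ => 1 - y * p ^ i) x = -(p ^ i / (1 - x * p ^ i)) :=
    fun i => by
      rw [logDeriv_apply]
      have : HasDerivAt (fun y : ℂ => 1 - y * p ^ i) (-(1 * p ^ i)) x :=
        ((hasDerivAt_id x).mul_const (p ^ i)).const_sub 1
      rw [this.deriv]
      ring
  have hs : Summable fun i : ℕ => logDeriv (fun y : ℂ => 1 - y * p ^ i) x := by
    simpa only [hlog] using (summable_pow_div_one_sub hp hx).neg
  have hne := qPochInf_ne_zero hp hx
  have key : logDeriv (fun y => qPochInf y p) x = _ :=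
    logDeriv_tprod_eq_tsum Metric.isOpen_ball hxm hx hd hs hm hne
  have e : deriv (fun y => qPochInf y p) x = -qPochInf x p * ∑' i : ℕ, p ^ i / (1 - x * p ^ i) := by
    rw [tsum_congr hlog, tsum_neg, logDeriv_apply, div_eq_iff hne] at key
    linear_combination key
  rw [← e]
  exact hdiff.hasDerivAt

theorem qPochInf_cube_root {w : ℂ} (hw : 1 + w + w ^ 2 = 0) (hq1 : ‖q‖ < 1) :
    qPochInf q q * qPochInf (w * q) q * qPochInf (w ^ 2 * q) q = qPochInf (q ^ 3) (q ^ 3) := by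
  refine tendsto_nhds_unique (((tendsto_qPoch q hq1).mul (tendsto_qPoch (w * q) hq1)).mul
    (tendsto_qPoch (w ^ 2 * q) hq1)) ((tendsto_qPoch (q ^ 3) (norm_cube_lt_one hq1)).congr fun n => ?_)
  simp only [qPoch, ← prod_mul_distrib]
  refine prod_congr rfl fun i _ => ?_
  have hx : (q ^ 3) ^ i = (q ^ i) ^ 3 := by ring
  rw [hx]
  have h3 : w ^ 3 = 1 := by linear_combination (w - 1) * hw
  generalize q ^ i = x
  linear_combination (q * x - w * (q * x) ^ 2) * hw + (q * x) ^ 3 * h3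

/-- Put z = w, a primitive cube root of unity, in the cube identity. The term with a(q) drops out as
θ(q³; 1) = 0, the other two theta values agree under z ↦ q³/z, and (1 - w)³ = -3(w - w²). -/
theorem thetaCubeCoeff_one_mul (hq0 : q ≠ 0) (hq1 : ‖q‖ < 1) :
    thetaCubeCoeff q 1 * thetaSum (q ^ 3) q = -3 * qPochInf (q ^ 3) (q ^ 3) ^ 3 := by
  have hp := norm_cube_lt_one hq1
  have hp0 : q ^ 3 ≠ 0 := pow_ne_zero 3 hq0
  obtain ⟨w, hw⟩ : ∃ w : ℂ, IsPrimitiveRoot w 3 := ⟨_, Complex.isPrimitiveRoot_exp 3 (by norm_num)⟩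
  have h3 : w ^ 3 = 1 := hw.pow_eq_one
  have hw1 : w ≠ 1 := hw.ne_one (by norm_num)
  have hw0 : w ≠ 0 := hw.ne_zero (by norm_num)
  have hs : 1 + w + w ^ 2 = 0 := by
    refine mul_left_cancel₀ (sub_ne_zero.2 hw1) ?_
    linear_combination h3
  have h1 : thetaSum (q ^ 3) 1 = 0 := by
    rw [thetaSum_eq hp0 hp one_ne_zero, qPochInf_eq_mul 1 hp 1]
    simp [qPoch]
  have h2 : thetaSum (q ^ 3) (q ^ 2) = thetaSum (q ^ 3) q := by
    rw [← thetaSum_div hp0 hq0]; congr 1; field_simp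
  have h4 : thetaSum q w = (1 - w) * qPochInf (q ^ 3) (q ^ 3) := by
    have e : q / w = w ^ 2 * q := by field_simp; linear_combination -h3
    rw [thetaSum_eq hq0 hq1 hw0, qPochInf_eq_mul w hq1 1, e, ← qPochInf_cube_root hs hq1]
    simp only [qPoch, range_one, prod_singleton, pow_zero, mul_one, pow_one]
    ring
  have key := thetaSum_pow_three hq0 hq1 hw0
  rw [h3, mul_one, mul_one, h1, h2, h4] at key
  have hne : w - w ^ 2 ≠ 0 := by
    have : w - w ^ 2 = w * (1 - w) := by ring
    rw [this]
    exact mul_ne_zero hw0 (sub_ne_zero.2 hw1.symm)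
  refine mul_left_cancel₀ hne ?_
  linear_combination -key - qPochInf (q ^ 3) (q ^ 3) ^ 3 * h3

theorem cubicTheta_eq_lambert (hq0 : q ≠ 0) (hq1 : ‖q‖ < 1) :
    cubicTheta q = 1 + 6 * (q * ∑' i : ℕ, (q ^ 3) ^ i / (1 - q * (q ^ 3) ^ i)
      - q ^ 2 * ∑' i : ℕ, (q ^ 3) ^ i / (1 - q ^ 2 * (q ^ 3) ^ i)) := by
  have hp := norm_cube_lt_one hq1
  have hp0 : q ^ 3 ≠ 0 := pow_ne_zero 3 hq0
  set p := q ^ 3 with hpq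
  set S := ∑' i : ℕ, p ^ i / (1 - q * p ^ i)
  set T := ∑' i : ℕ, p ^ i / (1 - q ^ 2 * p ^ i)
  have D1 := hasDerivAt_qPochInf hp (one_sub_mul_cube_pow_ne_zero hq1)
  have D2 := hasDerivAt_qPochInf hp (one_sub_pow_mul_ne_zero hq1 two_ne_zero)
  have D3 := hasDerivAt_qPochInf hp (one_sub_mul_pow_ne_zero hp hp.le)
  have D4 := hasDerivAt_qPochInf hq1 (one_sub_mul_pow_ne_zero hq1 hq1.le)
  have c3 : HasDerivAt (fun z : ℂ => z ^ 3) 3 1 := by simpa using hasDerivAt_pow 3 (1 : ℂ)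
  have up : ∀ a : ℂ, HasDerivAt (fun z : ℂ => a * z ^ 3) (a * 3) 1 := fun a => c3.const_mul a
  have dn : ∀ a : ℂ, HasDerivAt (fun z : ℂ => a / z ^ 3) (-(a * 3)) 1 := fun a => by
    have := (c3.inv (by simp)).const_mul a
    simpa [div_eq_mul_inv] using this
  have comp : ∀ {f : ℂ → ℂ} {g : ℂ → ℂ} {f' g' a : ℂ}, HasDerivAt f f' a → g 1 = a →
      HasDerivAt g g' 1 → HasDerivAt (fun z => f (g z)) (f' * g') 1 := fun hf ha hg => by
    rw [← ha] at hf; exact hf.comp 1 hg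
  have A1 := comp D1 (by simp) (up q)
  have A2 := comp D2 (by simp) (dn (q ^ 2))
  have A3 := comp D2 (by simp) (up (q ^ 2))
  have A4 := comp D1 (by simp) (dn q)
  have A5 := comp D3 (by simp) (up p)
  have A6 := comp D3 (by simp) (dn p)
  have A7 := comp D4 (by simp) ((hasDerivAt_id (1 : ℂ)).const_mul q)
  have A8 := comp (g := fun z => q / z) D4 (by simp)
    (by simpa [div_eq_mul_inv] using (hasDerivAt_inv (one_ne_zero : (1 : ℂ) ≠ 0)).const_mul q)
  have L := ((((hasDerivAt_id (1 : ℂ)).const_sub 1).mul ((A7.mul A8).const_mul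
    (qPochInf q q))).pow 3)
  have R0 := (c3.const_sub 1).mul ((A5.mul A6).const_mul (qPochInf p p))
  have R1 := (hasDerivAt_id (1 : ℂ)).mul ((A1.mul A2).const_mul (qPochInf p p))
  have R2 := (hasDerivAt_pow 2 (1 : ℂ)).mul ((A3.mul A4).const_mul (qPochInf p p))
  have R := (R0.const_mul (cubicTheta q)).add ((R1.sub R2).const_mul (thetaCubeCoeff q 1))
  -- `L` is the derivative of the cube, zero because of the factor (1 - z)³; `R` is that of the
  -- right-hand side in product form. They agree because the identity holds for all z ≠ 0, hence
  -- near 1.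
  have heq := R.unique (L.congr_of_eventuallyEq ?_)
  · have h1 := thetaCubeCoeff_one_mul hq0 hq1
    have e2 : p / q = q ^ 2 := by rw [hpq]; field_simp
    rw [← hpq, thetaSum_eq hp0 hp hq0, e2] at h1
    have hn := qPochInf_ne_zero hp (one_sub_mul_pow_ne_zero hp hp.le)
    simp at heq
    refine mul_left_cancel₀ (mul_ne_zero three_ne_zero (pow_ne_zero 3 hn)) ?_
    linear_combination -heq + (-1 - 6 * (q * S - q ^ 2 * T)) * h1
  · filter_upwards [isOpen_ne.mem_nhds (one_ne_zero : (1 : ℂ) ≠ 0)] with z hz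
    have hz3 : z ^ 3 ≠ 0 := pow_ne_zero 3 hz
    have t := thetaSum_pow_three hq0 hq1 hz
    have e1 : p / (q * z ^ 3) = q ^ 2 / z ^ 3 := by rw [hpq]; field_simp
    have e2 : p / (q ^ 2 * z ^ 3) = q / z ^ 3 := by rw [hpq]; field_simp
    rw [← hpq, thetaSum_eq hq0 hq1 hz, thetaSum_eq hp0 hp hz3,
      thetaSum_eq hp0 hp (mul_ne_zero hq0 hz3),
      thetaSum_eq hp0 hp (mul_ne_zero (pow_ne_zero 2 hq0) hz3), e1, e2,
      qPochInf_eq_mul z hq1 1, qPochInf_eq_mul (z ^ 3) hp 1] at t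
    simp only [qPoch, range_one, prod_singleton, pow_zero, mul_one, pow_one] at t
    simp only [Pi.add_apply, Pi.mul_apply, Pi.sub_apply, Pi.pow_apply, id]
    rw [mul_comm q z, mul_comm p (z ^ 3)]
    linear_combination -t

theorem cubicTheta_eq_gaussLogTerm (hq0 : q ≠ 0) (hq1 : ‖q‖ < 1) :
    cubicTheta q = 1 + 6 * ∑' j, gaussLogTerm q (q ^ 2) q (q ^ 3) j := by
  have hp := norm_cube_lt_one hq1
  have hc : ∀ i : ℕ, 1 - q * q * (q ^ 3) ^ i ≠ 0 := by
    simpa only [← sq] using one_sub_pow_mul_ne_zero hq1 two_ne_zero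
  have h := tendsto_sum_lambert q q hp hq1 hc
  rw [← sq] at h
  have h1 := (summable_pow_div_one_sub hp (one_sub_mul_cube_pow_ne_zero hq1)).hasSum.mul_left q
  have h2 := (summable_pow_div_one_sub hp (one_sub_pow_mul_ne_zero hq1 two_ne_zero)).hasSum.mul_left (q ^ 2)
  have h3 := (h1.sub h2).tendsto_sum_nat
  rw [cubicTheta_eq_lambert hq0 hq1, tendsto_nhds_unique h (h3.congr fun n => ?_)]
  refine sum_congr rfl fun i _ => ?_
  ring

end Lambert

/-! ### The four representations. -/

section Representations

variable {q : ℂ}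

theorem summable_and_tsum_pnat {f : ℕ+ → ℂ} {g : ℕ → ℂ} (h : ∀ n : ℕ, f n.succPNat = g n)
    (hg : Summable g) : Summable f ∧ ∑' n, f n = ∑' n, g n := by
  have e : g = f ∘ Equiv.pnatEquivNat.symm := funext fun n => (h n).symm
  constructor
  · rwa [e, Equiv.summable_iff] at hg
  · rw [e]
    exact (Equiv.pnatEquivNat.symm.tsum_eq f).symm

theorem pow_six_mul_succ_sub_one (hq0 : q ≠ 0) (m : ℕ) :
    q ^ (6 * (m + 1) - 1) = ((q ^ 3) ^ (m + 1)) ^ 2 / q := by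
  rw [eq_div_iff hq0, ← pow_succ, ← pow_mul, ← pow_mul]
  congr 1
  omega

theorem exists_norm_poisedFactor_le (hq1 : ‖q‖ < 1) {e₀ e₁ f₂ : ℂ}
    (h : ∃ C : ℝ, 0 < C ∧ ∀ m : ℕ, ‖∏ i ∈ range m,
      numCubic q e₀ e₁ f₂ ((q ^ 3) ^ i / q) / denCubic q e₀ e₁ f₂ ((q ^ 3) ^ i)‖ ≤ C) :
    ∃ C : ℝ, 0 < C ∧ ∀ m, ‖poisedFactor q e₀ e₁ f₂ m‖ ≤ C := by
  have hp := norm_cube_lt_one hq1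
  obtain ⟨A, hA, hA'⟩ := h
  obtain ⟨B, hB, hB'⟩ := exists_norm_qPoch_le (1 / q) hp
  obtain ⟨D, hD, hD'⟩ :=
    exists_norm_inv_qPoch_le hp (one_sub_pow_mul_ne_zero hq1 three_ne_zero)
  have h1 : ∀ m : ℕ, ‖1 - ((q ^ 3) ^ m) ^ 2 / q‖ ≤ 1 + 1 / ‖q‖ := fun m => by
    refine (norm_sub_le _ _).trans ?_
    rw [norm_one, norm_div, norm_pow, norm_pow _ m]
    gcongr
    exact pow_le_one₀ (by positivity) (pow_le_one₀ (norm_nonneg _) hp.le)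
  refine ⟨(1 + 1 / ‖q‖) * (B * (‖(1 - 1 / q)⁻¹‖ * D) * A) + 1, by positivity, fun m => ?_⟩
  rw [poisedFactor, poisedCore, div_eq_mul_inv (qPoch (1 / q) (q ^ 3) m), mul_inv]
  simp only [norm_mul]
  refine le_add_of_le_of_nonneg ?_ zero_le_one
  gcongr
  exacts [h1 m, hB' m, hD' m, hA' m]

theorem representation_three (hq0 : q ≠ 0) (hq1 : ‖q‖ < 1) {ρ₁ ρ₂ : ℂ} (h1 : ρ₁ ≠ 0) (h2 : ρ₂ ≠ 0)
    (h : ∀ j : ℕ, ρ₁ ≠ q ^ (3 * j + 2) ∧ ρ₂ ≠ q ^ (3 * j + 2) ∧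
      ρ₁ * ρ₂ * q ^ (3 * j + 1) ≠ 1) :
    Summable (seriesThreeFst q ρ₁ ρ₂) ∧ Summable (seriesThreeSnd q ρ₁ ρ₂) ∧
      cubicTheta q = 1 + 6 * ∑' n : ℕ+, seriesThreeFst q ρ₁ ρ₂ n
        - 6 * ∑' n : ℕ+, seriesThreeSnd q ρ₁ ρ₂ n := by
  have hp := norm_cube_lt_one hq1
  have d1 : ∀ i : ℕ, 1 - q ^ 2 / ρ₁ * (q ^ 3) ^ i ≠ 0 := fun i hi => (h i).1 (by
    rw [pow_add, pow_mul]; field_simp at hi; linear_combination hi)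
  have d2 : ∀ i : ℕ, 1 - q ^ 2 / ρ₂ * (q ^ 3) ^ i ≠ 0 := fun i hi => (h i).2.1 (by
    rw [pow_add, pow_mul]; field_simp at hi; linear_combination hi)
  have d3 : ∀ i : ℕ, 1 - ρ₁ * ρ₂ * q * (q ^ 3) ^ i ≠ 0 := fun i hi => (h i).2.2 (by
    rw [pow_add, pow_mul]; linear_combination -hi)
  -- With d₁, d₂, d₃ the denominator parameters q²/ρ₁, q²/ρ₂, ρ₁ρ₂q, of product q⁵, `e₁` is their
  -- sum and `f₂` is the sum of the q³/dᵢ, which is their second elementary symmetric function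
  -- divided by q².
  set e₁ := q ^ 2 / ρ₁ + q ^ 2 / ρ₂ + ρ₁ * ρ₂ * q with he₁
  set f₂ := q ^ 2 / (ρ₁ * ρ₂) + q * ρ₁ + q * ρ₂ with hf₂
  have hden : ∀ N, denCubic q 1 e₁ f₂ N
      = (1 - q ^ 2 / ρ₁ * N) * (1 - q ^ 2 / ρ₂ * N) * (1 - ρ₁ * ρ₂ * q * N) := fun N => by
    rw [denCubic, he₁, hf₂]; field_simp; ring
  have hnum : ∀ N, numCubic q 1 e₁ f₂ N
      = (1 - ρ₁ * q * N) * (1 - ρ₂ * q * N) * (1 - q ^ 2 / (ρ₁ * ρ₂) * N) := fun N => by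
    rw [numCubic, he₁, hf₂]; field_simp; ring
  have hnum' : ∀ N, numCubic q 1 e₁ f₂ (N / q)
      = (1 - ρ₁ * N) * (1 - ρ₂ * N) * (1 - q / (ρ₁ * ρ₂) * N) := fun N => by
    rw [hnum]; field_simp
  have hU : ∀ i : ℕ, denCubic q 1 e₁ f₂ ((q ^ 3) ^ i) ≠ 0 := fun i => by
    rw [hden]; exact mul_ne_zero (mul_ne_zero (d1 i) (d2 i)) (d3 i)
  have hP : ∀ n, ∏ i ∈ range n, numCubic q 1 e₁ f₂ ((q ^ 3) ^ i) / denCubic q 1 e₁ f₂ ((q ^ 3) ^ i)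
      = qPoch (ρ₁ * q) (q ^ 3) n * qPoch (ρ₂ * q) (q ^ 3) n
        * qPoch (q ^ 2 / (ρ₁ * ρ₂)) (q ^ 3) n / (qPoch (q ^ 2 / ρ₁) (q ^ 3) n
        * qPoch (q ^ 2 / ρ₂) (q ^ 3) n * qPoch (ρ₁ * ρ₂ * q) (q ^ 3) n) := fun n => by
    simp only [hnum, hden, prod_div_distrib, prod_mul_distrib, qPoch]
  have hP' : ∀ n, ∏ i ∈ range n,
      numCubic q 1 e₁ f₂ ((q ^ 3) ^ i / q) / denCubic q 1 e₁ f₂ ((q ^ 3) ^ i)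
      = qPoch ρ₁ (q ^ 3) n * qPoch ρ₂ (q ^ 3) n
        * qPoch (q / (ρ₁ * ρ₂)) (q ^ 3) n / (qPoch (q ^ 2 / ρ₁) (q ^ 3) n
        * qPoch (q ^ 2 / ρ₂) (q ^ 3) n * qPoch (ρ₁ * ρ₂ * q) (q ^ 3) n) := fun n => by
    simp only [hnum', hden, prod_div_distrib, prod_mul_distrib, qPoch]
  have hV : ∃ C : ℝ, 0 < C ∧ ∀ m, ‖poisedFactor q 1 e₁ f₂ m‖ ≤ C := by
    refine exists_norm_poisedFactor_le hq1 ?_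
    obtain ⟨A, hA, hA'⟩ := exists_norm_qPoch_le ρ₁ hp
    obtain ⟨B, hB, hB'⟩ := exists_norm_qPoch_le ρ₂ hp
    obtain ⟨C, hC, hC'⟩ := exists_norm_qPoch_le (q / (ρ₁ * ρ₂)) hp
    obtain ⟨D, hD, hD'⟩ := exists_norm_inv_qPoch_le hp d1
    obtain ⟨E, hE, hE'⟩ := exists_norm_inv_qPoch_le hp d2
    obtain ⟨F, hF, hF'⟩ := exists_norm_inv_qPoch_le hp d3
    refine ⟨A * B * C * (D * E * F), by positivity, fun m => ?_⟩
    rw [hP', div_eq_mul_inv, mul_inv, mul_inv]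
    simp only [norm_mul]
    gcongr
    exacts [hA' m, hB' m, hC' m, hD' m, hE' m, hF' m]
  obtain ⟨s1, s2, ht⟩ := poised_transformation hq0 hq1 hU hV
  obtain ⟨s1', t1⟩ := summable_and_tsum_pnat (f := seriesThreeFst q ρ₁ ρ₂) (fun n => by
    rw [hP, seriesThreeFst, Nat.succPNat_coe, Nat.succ_eq_add_one, pow_mul, div_mul_eq_mul_div,
      div_div]) s1
  obtain ⟨s2', t2⟩ := summable_and_tsum_pnat (f := seriesThreeSnd q ρ₁ ρ₂) (fun m => by
    rw [poisedFactor, poisedCore, hP', seriesThreeSnd, Nat.succPNat_coe, Nat.succ_eq_add_one,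
      pow_six_mul_succ_sub_one hq0]
    simp only [div_eq_mul_inv, mul_inv]
    ring) s2
  refine ⟨s1', s2', ?_⟩
  rw [t1, t2, ht, cubicTheta_eq_gaussLogTerm hq0 hq1]
  ring

theorem representation_one (hq0 : q ≠ 0) (hq1 : ‖q‖ < 1) :
    Summable (seriesOne q) ∧ cubicTheta q = 1 + 6 * ∑' n : ℕ+, seriesOne q n := by
  obtain ⟨s, t⟩ := summable_and_tsum_pnat (f := seriesOne q) (fun n => by
    rw [seriesOne, Nat.succPNat_coe, Nat.succ_eq_add_one, pow_mul, gaussLogTerm]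
    simp only [div_eq_mul_inv, mul_inv]
    ring) (summable_gaussLogTerm q (norm_cube_lt_one hq1)
      (one_sub_pow_mul_ne_zero hq1 two_ne_zero) hq1)
  exact ⟨s, by rw [t, cubicTheta_eq_gaussLogTerm hq0 hq1]⟩

/-- The choice ρ₁ = 1/q, ρ₂ = q makes ρ₁q = 1, so every term of the first series contains (1; q³)_n
= 0; in the second series two factors (q; q³)_n cancel. -/
theorem representation_two (hq0 : q ≠ 0) (hq1 : ‖q‖ < 1) :
    Summable (seriesTwo q) ∧ cubicTheta q = 1 - 6 * ∑' n : ℕ+, seriesTwo q n := by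
  obtain ⟨-, s, t⟩ := representation_three hq0 hq1 (one_div_ne_zero hq0) hq0 (fun j => by
    refine ⟨fun h => ?_, fun h => ?_, fun h => ?_⟩
    · refine one_sub_pow_ne_zero hq1 (n := 3 * j + 2 + 1) (by omega) ?_
      rw [pow_succ, ← h]; field_simp; ring
    · refine one_sub_pow_ne_zero hq1 (n := 3 * j + 1) (by omega) (mul_left_cancel₀ hq0 ?_)
      rw [pow_succ] at h
      linear_combination h
    · refine one_sub_pow_ne_zero hq1 (n := 3 * j + 1) (by omega) ?_
      rw [one_div_mul_cancel hq0, one_mul] at h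
      rw [h, sub_self])
  have z : ∀ n : ℕ+, seriesThreeFst q (1 / q) q n = 0 := fun n => by
    have : qPoch 1 (q ^ 3) n = 0 := by
      rw [qPoch, prod_eq_zero_iff]
      exact ⟨0, mem_range.2 n.pos, by simp⟩
    rw [seriesThreeFst, one_div_mul_cancel hq0, this]
    simp
  have e : seriesThreeSnd q (1 / q) q = seriesTwo q := funext fun n => by
    have hn := qPoch_ne_zero (one_sub_mul_cube_pow_ne_zero hq1) n
    have e1 : q ^ 2 / (1 / q) = q ^ 3 := by field_simp
    have e2 : q ^ 2 / q = q := by field_simp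
    rw [seriesThreeSnd, seriesTwo, one_div_mul_cancel hq0, e1, e2, div_one, one_mul]
    generalize qPoch q (q ^ 3) (n : ℕ) = A at *
    refine Eq.trans ?_ (mul_div_mul_left _ _ (mul_ne_zero hn hn))
    congr 1 <;> ring
  rw [e] at s t
  refine ⟨s, ?_⟩
  rw [t, tsum_congr z, tsum_zero]
  ring

theorem prod_neg_mul_pow (a p : ℂ) (n : ℕ) :
    ∏ i ∈ range n, -(a * p ^ i) = (-1) ^ n * a ^ n * p ^ n.choose 2 := by
  induction n with
  | zero => simp
  | succ n ih =>
    rw [prod_range_succ, ih, Nat.choose_succ_succ' n 1, Nat.choose_one_right, pow_add p]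
    ring

theorem two_mul_choose_two (n : ℕ) : 2 * n.choose 2 + n = n ^ 2 := by
  induction n with
  | zero => rfl
  | succ n ih =>
    rw [Nat.choose_succ_succ' n 1, Nat.choose_one_right]
    linarith

theorem representation_four (hq0 : q ≠ 0) (hq1 : ‖q‖ < 1) :
    Summable (seriesFourFst q) ∧ Summable (seriesFourSnd q) ∧
      cubicTheta q = 1 + 6 * ∑' n : ℕ+, seriesFourFst q n
        - 6 * ∑' n : ℕ+, seriesFourSnd q n := by
  have hpi : ∀ i : ℕ, (q ^ 3) ^ i ≠ 0 := fun i => pow_ne_zero _ (pow_ne_zero _ hq0)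
  -- As ρ₁, ρ₂ → ∞ the coefficient e₁ dominates, so (e₀, e₁, f₂) is taken as (0, 1, 0): the cubics
  -- become -N and qN², and their ratio is -qN.
  have hU : ∀ i : ℕ, denCubic q 0 1 0 ((q ^ 3) ^ i) ≠ 0 := fun i => by
    simpa [denCubic] using hpi i
  have hP : ∀ n, ∏ i ∈ range n, numCubic q 0 1 0 ((q ^ 3) ^ i) / denCubic q 0 1 0 ((q ^ 3) ^ i)
      = (-1) ^ n * q ^ n * (q ^ 3) ^ n.choose 2 := fun n => by
    rw [← prod_neg_mul_pow]
    refine prod_congr rfl fun i _ => ?_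
    rw [div_eq_iff (hU i), numCubic, denCubic]
    ring
  have hP' : ∀ n, ∏ i ∈ range n,
      numCubic q 0 1 0 ((q ^ 3) ^ i / q) / denCubic q 0 1 0 ((q ^ 3) ^ i)
      = (-1) ^ n * (1 / q) ^ n * (q ^ 3) ^ n.choose 2 := fun n => by
    rw [← prod_neg_mul_pow]
    refine prod_congr rfl fun i _ => ?_
    rw [div_eq_iff (hU i), numCubic, denCubic]
    field_simp
    ring
  have hV : ∃ C : ℝ, 0 < C ∧ ∀ m, ‖poisedFactor q 0 1 0 m‖ ≤ C := by
    have hq : 0 < ‖q‖ := norm_pos_iff.2 hq0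
    refine exists_norm_poisedFactor_le hq1 ⟨1 / ‖q‖, by positivity, fun m => ?_⟩
    -- The product has absolute value |q|^{3m(m-1)/2 - m}; its exponent is at least -1, which
    -- explains the bound 1/|q|.
    have hm : m ≤ 3 * m.choose 2 + 1 := by
      have := two_mul_choose_two m
      nlinarith [sq_nonneg ((m : ℤ) - 1)]
    have := pow_le_pow_of_le_one hq.le hq1.le hm
    rw [hP']
    simp only [norm_mul, norm_pow, norm_neg, norm_one, one_pow, one_mul, norm_div]
    rw [div_pow, one_pow, one_div_mul_eq_div, div_le_div_iff₀ (by positivity) hq, ← pow_mul,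
      ← pow_succ, one_mul]
    exact this
  obtain ⟨s1, s2, ht⟩ := poised_transformation hq0 hq1 hU hV
  obtain ⟨s1', t1⟩ := summable_and_tsum_pnat (f := seriesFourFst q) (fun n => by
    have e : (3 * (n + 1) ^ 2 + (n + 1)) / 2 = (n + 1) + (n + 1) + 3 * (n + 1).choose 2 := by
      have := two_mul_choose_two (n + 1)
      omega
    rw [hP, seriesFourFst, Nat.succPNat_coe, Nat.succ_eq_add_one, e, pow_mul q 3, pow_add, pow_add,
      pow_mul q 3]
    ring) s1
  obtain ⟨s2', t2⟩ := summable_and_tsum_pnat (f := seriesFourSnd q) (fun m => by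
    have e : (3 * (m + 1) ^ 2 - (m + 1)) / 2 = (m + 1) + 3 * (m + 1).choose 2 := by
      have := two_mul_choose_two (m + 1)
      omega
    have hq2 : (1 / q) ^ (m + 1) * q ^ (2 * (m + 1)) = q ^ (m + 1) := by
      rw [two_mul, pow_add q, ← mul_assoc, ← mul_pow, one_div_mul_cancel hq0, one_pow, one_mul]
    rw [poisedFactor, poisedCore, hP', seriesFourSnd, Nat.succPNat_coe, Nat.succ_eq_add_one,
      pow_six_mul_succ_sub_one hq0, e, pow_add q (m + 1), pow_mul q 3, ← hq2]
    simp only [div_eq_mul_inv, mul_inv]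
    ring) s2
  refine ⟨s1', s2', ?_⟩
  rw [t1, t2, ht, cubicTheta_eq_gaussLogTerm hq0 hq1]
  ring

end Representations

/-- For `0 < |q| < 1` all the series involved converge, and `a(q)` has the four representations;
in the third one `ρ₁, ρ₂` are arbitrary nonzero parameters for which no denominator vanishes. -/
theorem corollary4 (q : ℂ) (hq0 : 0 < ‖q‖) (hq1 : ‖q‖ < 1) :
    Summable (cubicThetaTerm q) ∧
    (Summable (seriesOne q) ∧
      cubicTheta q = 1 + 6 * ∑' n : ℕ+, seriesOne q n) ∧
    (Summable (seriesTwo q) ∧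
      cubicTheta q = 1 - 6 * ∑' n : ℕ+, seriesTwo q n) ∧
    (∀ ρ₁ ρ₂ : ℂ, ρ₁ ≠ 0 → ρ₂ ≠ 0 →
      (∀ j : ℕ, ρ₁ ≠ q ^ (3 * j + 2) ∧ ρ₂ ≠ q ^ (3 * j + 2) ∧
        ρ₁ * ρ₂ * q ^ (3 * j + 1) ≠ 1) →
      Summable (seriesThreeFst q ρ₁ ρ₂) ∧ Summable (seriesThreeSnd q ρ₁ ρ₂) ∧
      cubicTheta q = 1 + 6 * ∑' n : ℕ+, seriesThreeFst q ρ₁ ρ₂ n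
        - 6 * ∑' n : ℕ+, seriesThreeSnd q ρ₁ ρ₂ n) ∧
    (Summable (seriesFourFst q) ∧ Summable (seriesFourSnd q) ∧
      cubicTheta q = 1 + 6 * ∑' n : ℕ+, seriesFourFst q n
        - 6 * ∑' n : ℕ+, seriesFourSnd q n) := by
  have h0 : q ≠ 0 := norm_pos_iff.1 hq0
  exact ⟨summable_cubicThetaTerm h0 hq1, representation_one h0 hq1, representation_two h0 hq1,
    fun ρ₁ ρ₂ h1 h2 h => representation_three h0 hq1 h1 h2 h, representation_four h0 hq1⟩
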